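/- **Setting.** Let $B>0$, $J\in\mathbb N$, $B_{\rm nyq}=JB$, $0<T\le 1/B_{\rm nyq}$, $W=BT/2$. For $0\le i<J$ let $\Delta_i=[-\tfrac{B_{\rm nyq}}2+iB,\,-\tfrac{B_{\rm nyq}}2+(i+1)B]$, with midpoint $F_i$, and $f_i=F_iT$. Let $N\ge1$, and let $s^{(0)},\dots,s^{(N-1)}:\mathbb Z\to\mathbb R$ be the discrete prolate spheroidal sequences with eigenvalues $\lambda^{(0)}\ge\dots\ge\lambda^{(N-1)}$: $\mathcal B_W(\mathcal T_N s^{(\ell)})=\lambda^{(\ell)}s^{(\ell)}$, where $\mathcal T_N$ zeroes a sequence outside $\{0,\dots,N-1\}$ and $\mathcal B_W$ restricts the discrete-time Fourier transform to $|f|\le W$, and the $\mathcal T_Ns^{(\ell)}$ are orthonormal. For $k\in\{1,\dots,N\}$ the multiband modulated DPSS dictionary is $\Psi=[\Psi_0\cdots\Psi_{J-1}]$, where $\Psi_i\in\mathbb C^{N\times k}$ has columns $(e^{2\pi \mathrm{i} f_i n}s^{(\ell)}[n])_{0\le n<N}$, $0\le\ell<k$. For $I\subseteq\{0,\dots,J-1\}$,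 $\mathcal R(\Psi_I)$ is the span of the columns of the blocks $\Psi_i$, $i\in I$. *Signal.* Let $K\ge1$, $|I|=K$, and $x(t)=\sum_{i\in I}x_i(t)$ be a complex Gaussian process (real and imaginary parts jointly Gaussian), where the $x_i$ are independent, zero-mean, (jointly) wide sense stationary, with power spectrum $\frac1{KB}$ on $\Delta_i$ and $0$ elsewhere. Let $\mathbf x=[x(0)\ x(T)\cdots x((N-1)T)]^T\in\mathbb C^N$, and let $\mathbf x'$ be the orthogonal projection of $\mathbf x$ onto $\mathcal R(\Psi_I)$. *Measurements.* Let $A$ be a real $M\times N$ random matrix, independent of $\mathbf x$, with i.i.d. entries that have mean $0$, variance $1/M$ and are subgaussian with constant $c_0>0$, i.e. $\mathbb E\,e^{A[m,n]t}\le e^{c_0^2t^2/M}$ for all $t\in\mathbb R$. Let $\mathbf y=A\mathbf x$. A function $c_1$ is called a *concentration constant* for $A$ if for every $\eta>0$ one has $c_1(\eta)>0$ and $$\mathbb P\big(\big|\|A\mathbf v\|_2^2-\|\mathbf v\|_2^2\big|\ge\eta\|\mathbf v\|_2^2\big)\le4e^{-c_1(\eta)M}\quad\text{for all fixed } 0\ne\mathbf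 v\in\mathbb C^N .$$ *Algorithm.* Block-based IHT with parameter $\mu$ generates $\mathbf x^0=0$, $\mathbf x^{n+1}=\mathcal P(\mathbf x^n+\mu A^H(\mathbf y-A\mathbf x^n),K)$, where $\mathcal P(\mathbf v,K)$ is a point of $\mathcal R(\Psi_{S})$ closest to $\mathbf v$, and $S$ minimizes the distance of $\mathbf v$ to $\mathcal R(\Psi_S)$ over all $S$ with $|S|\le K$ (ties broken arbitrarily). For a tolerance $\tau>0$, the stopping criterion is met at iteration $n$ if $\big(\tfrac{1}{\mu(1-\delta)}-1\big)^n\|\mathbf x'\|_2^2\le\tau^2\|A(\mathbf x-\mathbf x')\|_2^2$. **Theorem.** There are a universal constant $c_2>0$ and constants $\kappa_1=\kappa_1(\delta,\tau)>1$, depending only on $\delta$ and $\tau$, such that the following holds for every $c_0>0$. (a) There is a function $c_1$, depending only on $c_0$, that is a concentration constant for all such matrices $A$ of all sizes $M\times N$ and all entry laws subgaussian with constant $c_0$. (b) In the setting above, let $k\in\{1,\dots,N\}$, $\delta\in(0,0.2)$, $\beta\in(0,1)$, $\eta,\gamma,\tau>0$, $\frac1\mu\in[1+\delta,1.5(1-\delta))$,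 and let $c_1$ be any concentration constant for $A$. If $$M\ge\frac{4K\left(k\log(42/\delta)+\log(eJ/2K)\right)+\log(4/\beta)}{c_1(\delta/\sqrt2)},$$ then, with probability at least $1-\beta-4e^{-c_1(\eta)M}-2e^{-\min(\gamma^2/c_2^2,\ \gamma/c_2)}$, for every sequence of iterates of block-based IHT, the estimate $\widehat{\mathbf x}=\mathbf x^n$ at every iteration $n$ at which the stopping criterion is met satisfies $$\|\mathbf x-\widehat{\mathbf x}\|_2^2\le(1+\kappa_1(1+\eta)^{1/2})^2(1+\gamma)\frac K{2W}\sum_{\ell=k}^{N-1}\lambda^{(\ell)},$$ and $\limsup_{n\to\infty}\|\mathbf x-\mathbf x^n\|_2^2$ is at most the same right-hand side. -/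

import Mathlib

open MeasureTheory ProbabilityTheory Filter
open scoped Matrix ComplexConjugate

noncomputable section

/-! ### Discrete prolate spheroidal sequences -/

/-- The discrete-time Fourier transform `X(f) = ∑ₙ x[n] e^{-j2πfn}`. -/
def dtft (x : ℤ → ℂ) (f : ℝ) : ℂ :=
  ∑' n : ℤ, x n * Complex.exp (-(2 * Real.pi * f * n : ℝ) * Complex.I)

/-- The operator that restricts the DTFT of a sequence to `|f| ≤ W` and returns to the time
domain. It is only applied to finitely supported sequences below. -/
def bandLimit (W : ℝ) (x : ℤ → ℂ) (n : ℤ) : ℂ :=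
  ∫ f in (-W)..W, dtft x f * Complex.exp ((2 * Real.pi * f * n : ℝ) * Complex.I)

/-- The operator that zeroes all entries outside `{0, …, N-1}`. -/
def timeLimit (N : ℕ) (x : ℤ → ℝ) (n : ℤ) : ℝ :=
  if 0 ≤ n ∧ n < N then x n else 0

/-- `s` is the collection of the `N` (real) discrete prolate spheroidal sequences with parameters
`N` and `W`, with eigenvalues `lam` in decreasing order: `B_W (T_N s⁽ˡ⁾) = λ⁽ˡ⁾ s⁽ˡ⁾`,
with time-limited sequences `T_N s⁽ˡ⁾` of unit norm and mutually orthogonal.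
For `0 < W < 1/2` the `N` eigenvalues of `B_W T_N` are in fact distinct and lie in `(0, 1)`, so
that these conditions determine `lam`, and `s` up to signs. -/
structure IsDPSS (N : ℕ) (W : ℝ) (s : Fin N → ℤ → ℝ) (lam : Fin N → ℝ) : Prop where
  eigen : ∀ l n, bandLimit W (fun m => (timeLimit N (s l) m : ℂ)) n = ((lam l * s l n : ℝ) : ℂ)
  norm_one : ∀ l, ∑ n : Fin N, s l (n : ℕ) ^ 2 = 1
  orthogonal : ∀ l l', l ≠ l' → ∑ n : Fin N, s l (n : ℕ) * s l' (n : ℕ) = 0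
  antitone : Antitone lam

/-! ### The multiband modulated DPSS dictionary -/

/-- The `i`-th band `Δ_i = [-Bnyq/2 + i B, -Bnyq/2 + (i+1) B]`. -/
def band (Bnyq B : ℝ) (i : ℕ) : Set ℝ :=
  Set.Icc (-Bnyq / 2 + i * B) (-Bnyq / 2 + (i + 1) * B)

/-- The midpoint `F_i` of the `i`-th band. -/
def bandCenter (Bnyq B : ℝ) (i : ℕ) : ℝ := -Bnyq / 2 + (i + 1 / 2) * B

/-- The matrix `S_{N,W}` with the DPSS vectors (DPSS restricted to `0, …, N-1`) as columns. -/
def dpssMatrix {N : ℕ} (s : Fin N → ℤ → ℝ) : Matrix (Fin N) (Fin N) ℂ :=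
  Matrix.of fun n l => (s l (n : ℕ) : ℂ)

/-- The modulator `E_f = diag(e^{j2πf·0}, …, e^{j2πf(N-1)})`. -/
def modulator (N : ℕ) (f : ℝ) : Matrix (Fin N) (Fin N) ℂ :=
  Matrix.diagonal fun n => Complex.exp ((2 * Real.pi * f * (n : ℕ) : ℝ) * Complex.I)

/-- The dictionary `Ψ = [Ψ_0 … Ψ_{J-1}]`, where `Ψ_i` consists of the first `k` columns of
`E_{f_i} S_{N,W}` with `f_i = F_i T`; the column `(i, l)` is the `l`-th column of the block
`Ψ_i`. -/
def multibandDictionary {N k : ℕ} (J : ℕ) (hk : k ≤ N) (Bnyq B T : ℝ) (s : Fin N → ℤ → ℝ) :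
    Matrix (Fin N) (Fin J × Fin k) ℂ :=
  Matrix.of fun n p =>
    (modulator N (bandCenter Bnyq B p.1 * T) * dpssMatrix s) n (Fin.castLE hk p.2)

/-! ### Block-based iterative hard thresholding -/

/-- The range of the submatrix `Ψ_I` formed by the blocks of `Ψ` indexed by `I`. -/
def blockRange {N J k : ℕ} (Ψ : Matrix (Fin N) (Fin J × Fin k) ℂ) (I : Finset (Fin J)) :
    Submodule ℂ (EuclideanSpace ℂ (Fin N)) :=
  Submodule.span ℂ {v | ∃ i ∈ I, ∃ l, v = WithLp.toLp 2 (fun n => Ψ n (i, l))}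

/-- `I` is a value of `S_Ψ(x, K)`: a set of at most `K` blocks whose range is closest to `x`. -/
def IsBlockSupport {N J k : ℕ} (Ψ : Matrix (Fin N) (Fin J × Fin k) ℂ)
    (x : EuclideanSpace ℂ (Fin N)) (K : ℕ) (I : Finset (Fin J)) : Prop :=
  I.card ≤ K ∧ ∀ I' : Finset (Fin J), I'.card ≤ K →
    Metric.infDist x (blockRange Ψ I : Set (EuclideanSpace ℂ (Fin N))) ≤
      Metric.infDist x (blockRange Ψ I' : Set (EuclideanSpace ℂ (Fin N)))

/-- `z` is a value of `P_Ψ(x, K)`: a closest point to `x` in the range of `Ψ_I`,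
`I = S_Ψ(x, K)`. The relation allows every way to break ties in the choice of `I`. -/
def IsBlockProj {N J k : ℕ} (Ψ : Matrix (Fin N) (Fin J × Fin k) ℂ)
    (x : EuclideanSpace ℂ (Fin N)) (K : ℕ) (z : EuclideanSpace ℂ (Fin N)) : Prop :=
  ∃ I, IsBlockSupport Ψ x K I ∧ z ∈ blockRange Ψ I ∧ ∀ z' ∈ blockRange Ψ I, ‖x - z‖ ≤ ‖x - z'‖

/-- The action `x ↦ A x` of a real `M × N` matrix on `ℂ^N`. -/
def applyMatrix {M N : ℕ} (A : Matrix (Fin M) (Fin N) ℝ) (x : EuclideanSpace ℂ (Fin N)) :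
    EuclideanSpace ℂ (Fin M) :=
  WithLp.toLp 2 (A.map Complex.ofReal *ᵥ x.ofLp)

/-- `u` is a sequence of iterates of block-based IHT with input `y` and parameter `μ`:
`u⁰ = 0` and `u^{ℓ+1} = P_Ψ(u^ℓ + μ A^H (y - A u^ℓ), K)`. -/
def IsBlockIHT {M N J k : ℕ} (A : Matrix (Fin M) (Fin N) ℝ)
    (Ψ : Matrix (Fin N) (Fin J × Fin k) ℂ) (K : ℕ) (μ : ℝ) (y : EuclideanSpace ℂ (Fin M))
    (u : ℕ → EuclideanSpace ℂ (Fin N)) : Prop :=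
  u 0 = 0 ∧ ∀ l,
    IsBlockProj Ψ (u l + (μ : ℂ) • applyMatrix Aᵀ (y - applyMatrix A (u l))) K (u (l + 1))

/-! ### Subgaussian matrices -/

/-- `ν` is a law for the entries of an `M × N` subgaussian matrix with constant `c₀`: it has mean
zero and variance `1/M`, and `√M` times an entry has moment generating function at most
`e^{c₀² t²}`. -/
structure IsSubgaussianEntryLaw (c₀ : ℝ) (M : ℕ) (ν : Measure ℝ) : Prop where
  isProbabilityMeasure : IsProbabilityMeasure ν
  mean_zero : Integrable (fun a => a) ν ∧ ∫ a, a ∂ν = 0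
  variance : Integrable (fun a => a ^ 2) ν ∧ ∫ a, a ^ 2 ∂ν = 1 / M
  mgf_le : ∀ t : ℝ, Integrable (fun a => Real.exp (a * t)) ν ∧
    ∫ a, Real.exp (a * t) ∂ν ≤ Real.exp (c₀ ^ 2 * t ^ 2 / M)

/-- `c₁` is a concentration constant for `M × N` matrices `A` with i.i.d. entries of law `ν`:
for every `η > 0`, `c₁(η) > 0` and, for every fixed `x ≠ 0` in `ℂ^N`,
`ℙ(|‖Ax‖² - ‖x‖²| ≥ η‖x‖²) ≤ 4 e^{-c₁(η) M}`. -/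
def IsConcentrationConstant (M N : ℕ) (ν : Measure ℝ) (c₁ : ℝ → ℝ) : Prop :=
  ∀ η : ℝ, 0 < η → 0 < c₁ η ∧ ∀ x : EuclideanSpace ℂ (Fin N), x ≠ 0 →
    (Measure.pi fun _ : Fin M × Fin N => ν)
      {a | η * ‖x‖ ^ 2 ≤ |‖applyMatrix (Matrix.of fun m n => a (m, n)) x‖ ^ 2 - ‖x‖ ^ 2|} ≤
        ENNReal.ofReal (4 * Real.exp (-c₁ η * M))

/-! ### The multiband random process model -/

/-- `X` is a zero-mean, wide sense stationary, complex-valued process with (integrable) power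
spectrum `S`, i.e. its autocorrelation `r(τ) = 𝔼[X(t+τ) conj X(t)]` is the inverse Fourier
transform of `S`. -/
structure IsWSSWithSpectrum {Ω : Type*} [MeasurableSpace Ω] (P : Measure Ω)
    (X : ℝ → Ω → ℂ) (S : ℝ → ℝ) : Prop where
  measurable : ∀ t, Measurable (X t)
  memLp_two : ∀ t, MemLp (X t) 2 P
  mean_zero : ∀ t, ∫ ω, X t ω ∂P = 0
  autocorrelation : ∀ t τ : ℝ, ∫ ω, X (t + τ) ω * conj (X t ω) ∂P =
    ∫ F : ℝ, (S F : ℂ) * Complex.exp ((2 * Real.pi * F * τ : ℝ) * Complex.I)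

/-- `x(t) = ∑_{i ∈ I} x_i(t)`, where the `x_i` are independent zero-mean wide sense stationary
processes, `x_i` with power spectrum `1/(K B)` on the band `Δ_i` and zero elsewhere, `K = |I|`.
(Joint wide sense stationarity is automatic for independent zero-mean processes.) -/
def IsMultibandProcess {Ω : Type*} [MeasurableSpace Ω] (P : Measure Ω) {J : ℕ} (Bnyq B : ℝ)
    (I : Finset (Fin J)) (x : ℝ → Ω → ℂ) : Prop :=
  ∃ X : I → ℝ → Ω → ℂ,
    (∀ i : I, IsWSSWithSpectrum P (X i)
      ((band Bnyq B (i : Fin J)).indicator fun _ => 1 / (I.card * B))) ∧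
    iIndepFun (fun (i : I) ω t => X i t ω) P ∧
    ∀ t ω, x t ω = ∑ i : I, X i t ω

/-- The vector `[x(0) x(T) … x((N-1)T)]` of samples of a signal. -/
def sampleVector (N : ℕ) (T : ℝ) (x : ℝ → ℂ) : EuclideanSpace ℂ (Fin N) :=
  WithLp.toLp 2 fun n : Fin N => x ((n : ℕ) * T)

end

noncomputable section

/-! ### Squares of subgaussian random variables -/

/-! Write `d = ‖x - x'‖` for the part of the sample vector outside the active blocks and `b = ‖A (x
- x')‖`. The theorem combines a deterministic convergence statement with three events whose failure
probabilities add up.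

Deterministic part: suppose `A` is a `δ`-almost isometry on unions of `2K` blocks. An IHT step
minimizes a quadratic majorant of the residual, because `1/μ ≥ 1 + δ`. Comparing the new iterate
with `x'` contracts `‖A (x^n - x')‖` by `√ρ`, up to an error `2b`, where `ρ = 1/(μ(1-δ)) - 1 ≤ 1/2`.
Hence `‖x' - x^n‖ ≤ 2 √ρ^n ‖x'‖ + 8b` (`IsBlockIHT.norm_sub_le`). The stopping criterion says
exactly that `√ρ^n ‖x'‖ ≤ τ b`, which gives `κ₁ = 2|τ| + 8`.

Events. (1) Restricted isometry: a union bound over nets of the unit spheres of all unions of blocks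
(`exists_measurableSet_blockRIP`). (2) `b² ≤ (1 + η) d²`: since `A` is independent of the samples,
the concentration bound applies conditionally on them. (3) `d² ≤ (1 + γ) V`, where `V` is the bound
on the expected energy: `d²` is a sum of squares of centred Gaussians, so Bernstein applies with the
variances as subgaussian parameters (`measure_sum_sq_gt_le`).

The bound `V` comes from the identity that `λ^(ℓ)` is the energy of the truncated DPSS in `[-W, W]`.
A process with flat spectrum on one band therefore has expected power proportional to `λ^(ℓ)` along
the `ℓ`-th modulated DPSS vector, and only `ℓ ≥ k` escapes the block.

The existence of a concentration constant rests on the same estimate as (3): the centred square of a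
subgaussian variable is subexponential (`integral_exp_centered_sq_le`), applied to the independent
rows of `A`. -/

theorem lintegral_exp_sq_div_eight_gaussianReal_le :
    ∫⁻ g, ENNReal.ofReal (Real.exp (g ^ 2 / 8)) ∂(gaussianReal 0 1) ≤ 2 := by
  rw [gaussianReal_of_var_ne_zero 0 one_ne_zero,
    lintegral_withDensity_eq_lintegral_mul _ (measurable_gaussianPDF 0 1) (by fun_prop)]
  have h : ∀ g : ℝ, (gaussianPDF 0 1 * fun g => ENNReal.ofReal (Real.exp (g ^ 2 / 8))) g =
      ENNReal.ofReal ((√(2 * Real.pi))⁻¹ * Real.exp (-(3 / 8) * g ^ 2)) := by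
    intro g
    rw [Pi.mul_apply, gaussianPDF, ← ENNReal.ofReal_mul (gaussianPDFReal_nonneg _ _ _),
      gaussianPDFReal, mul_assoc, ← Real.exp_add]
    congr 3
    · simp
    · simp; ring
  simp_rw [h]
  rw [← ofReal_integral_eq_lintegral_ofReal
    ((integrable_exp_neg_mul_sq (by norm_num)).const_mul _)
    (ae_of_all _ fun g => by positivity), integral_const_mul, integral_gaussian,
    ← Real.sqrt_inv, ← Real.sqrt_mul (by positivity)]
  rw [show (2 * Real.pi)⁻¹ * (Real.pi / (3 / 8)) = 4 / 3 by field_simp; norm_num]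
  rw [← ENNReal.ofReal_ofNat 2]
  apply ENNReal.ofReal_le_ofReal
  rw [Real.sqrt_le_left (by norm_num)]
  norm_num

section

open scoped NNReal ENNReal

variable {Ω : Type*} [MeasurableSpace Ω] {P : Measure Ω}

/-- Linearization of the square: for an auxiliary standard Gaussian `g`, `exp (X²/(8c))` is the
`g`-average of `exp (X g/(2√c))`. After Tonelli, the subgaussian bound at `t = g/(2√c)` leaves the
average of `exp (g²/8)`. -/
theorem lintegral_exp_sq_le_of_hasSubgaussianMGF [IsProbabilityMeasure P] {X : Ω → ℝ}
    {c : ℝ≥0} (hX : Measurable X) (h : HasSubgaussianMGF X c P) (hc : 0 < c) :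
    ∫⁻ ω, ENNReal.ofReal (Real.exp (X ω ^ 2 / (8 * c))) ∂P ≤ 2 := by
  have hc' : (0 : ℝ) < c := hc
  have hs : √(c : ℝ) ^ 2 = c := Real.sq_sqrt hc'.le
  have hs0 : 0 < √(c : ℝ) := Real.sqrt_pos.2 hc'
  have h1 : ∀ ω, ENNReal.ofReal (Real.exp (X ω ^ 2 / (8 * c))) =
      ∫⁻ g, ENNReal.ofReal (Real.exp (X ω / (2 * √c) * g)) ∂(gaussianReal 0 1) := by
    intro ω
    have := congrFun (mgf_id_gaussianReal (μ := 0) (v := 1)) (X ω / (2 * √c))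
    rw [← ofReal_integral_eq_lintegral_ofReal (integrable_exp_mul_gaussianReal _)
      (ae_of_all _ fun g => by positivity)]
    simp only [mgf, id] at this
    rw [this]
    congr 2
    simp only [zero_mul, zero_add, NNReal.coe_one, one_mul, div_pow, mul_pow, hs]
    field_simp
    norm_num
  simp_rw [h1]
  rw [lintegral_lintegral_swap (by
    apply Measurable.aemeasurable
    unfold Function.uncurry
    fun_prop)]
  refine le_trans (lintegral_mono fun g => ?_) lintegral_exp_sq_div_eight_gaussianReal_le
  have h2 : ∀ ω, X ω / (2 * √c) * g = g / (2 * √c) * X ω := fun ω => by ring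
  simp_rw [h2]
  rw [← ofReal_integral_eq_lintegral_ofReal (h.integrable_exp_mul _)
      (ae_of_all _ fun g => by positivity)]
  apply ENNReal.ofReal_le_ofReal
  refine (h.mgf_le _).trans_eq ?_
  congr 1
  rw [div_pow, mul_pow, hs]
  field_simp
  norm_num

theorem integrable_exp_sq_of_hasSubgaussianMGF [IsProbabilityMeasure P] {X : Ω → ℝ}
    {c : ℝ≥0} (hX : Measurable X) (h : HasSubgaussianMGF X c P) (hc : 0 < c) :
    Integrable (fun ω => Real.exp (X ω ^ 2 / (8 * c))) P ∧
      ∫ ω, Real.exp (X ω ^ 2 / (8 * c)) ∂P ≤ 2 := by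
  have h1 := lintegral_exp_sq_le_of_hasSubgaussianMGF hX h hc
  have h2 : Integrable (fun ω => Real.exp (X ω ^ 2 / (8 * c))) P := by
    refine ⟨by fun_prop, ?_⟩
    rw [hasFiniteIntegral_iff_ofReal (ae_of_all _ fun g => by positivity)]
    exact h1.trans_lt (by simp)
  refine ⟨h2, ?_⟩
  rw [← ofReal_integral_eq_lintegral_ofReal h2 (ae_of_all _ fun g => by positivity)] at h1
  rwa [← ENNReal.ofReal_ofNat 2, ENNReal.ofReal_le_ofReal_iff (by norm_num)] at h1

theorem exp_le_one_add_add_sq_mul_exp_abs (w : ℝ) :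
    Real.exp w ≤ 1 + w + w ^ 2 * Real.exp |w| := by
  have h := Complex.norm_exp_sub_sum_le_norm_mul_exp (w : ℂ) 2
  have e : Complex.exp w - ∑ m ∈ Finset.range 2, (w : ℂ) ^ m / m.factorial =
      ((Real.exp w - (1 + w) : ℝ) : ℂ) := by
    simp [Finset.sum_range_succ]
  rw [e, Complex.norm_real, Complex.norm_real, Real.norm_eq_abs, Real.norm_eq_abs, sq_abs] at h
  linarith [le_abs_self (Real.exp w - (1 + w))]

/-- The centred square of a subgaussian random variable is subexponential. -/
theorem integral_exp_centered_sq_le [IsProbabilityMeasure P] {X : Ω → ℝ} {c : ℝ≥0}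
    (hX : Measurable X) (h : HasSubgaussianMGF X c P) (hc : 0 < c) {v : ℝ}
    (hv : ∫ ω, X ω ^ 2 ∂P = v) {θ : ℝ} (hθ : |θ| * c ≤ 1 / 16) :
    Integrable (fun ω => Real.exp (θ * (X ω ^ 2 - v))) P ∧
      ∫ ω, Real.exp (θ * (X ω ^ 2 - v)) ∂P ≤ Real.exp (3072 * (θ * c) ^ 2) := by
  have hc' : (0 : ℝ) < c := hc
  obtain ⟨hi, hle⟩ := integrable_exp_sq_of_hasSubgaussianMGF hX h hc
  have hsq : Integrable (fun ω => X ω ^ 2) P := (h.memLp 2).integrable_sq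
  have hv0 : 0 ≤ v := hv ▸ integral_nonneg fun ω => sq_nonneg _
  -- Integrating `y + 1 ≤ exp y` for `y = X²/(8c)` against the bound 2 on the exponential moment.
  have hv8 : v / (8 * c) ≤ 1 := by
    have : ∫ ω, (X ω ^ 2 / (8 * c) + 1) ∂P ≤ ∫ ω, Real.exp (X ω ^ 2 / (8 * c)) ∂P :=
      integral_mono ((hsq.div_const _).add (integrable_const _)) hi
        fun ω => Real.add_one_le_exp _
    rw [integral_add (hsq.div_const _) (integrable_const _), integral_div, hv] at this
    simp at this
    linarith
  have hev : Real.exp (v / (8 * c)) ≤ 3 :=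
    (Real.exp_le_exp.2 hv8).trans Real.exp_one_lt_three.le
  -- The linear term has mean zero. The quadratic remainder is absorbed by `exp (X²/(8c))`, with
  -- `1536 = 512 * 3`: 512 from `y²/2 ≤ exp y` at `y = r/16`, and 3 from `exp (v/(8c))`. The
  -- exponential moment bound 2 then yields 3072.
  have key : ∀ ω, Real.exp (θ * (X ω ^ 2 - v)) ≤ 1 + θ * (X ω ^ 2 - v) +
      1536 * (θ * c) ^ 2 * Real.exp (X ω ^ 2 / (8 * c)) := by
    intro ω
    set w := θ * (X ω ^ 2 - v)
    refine (exp_le_one_add_add_sq_mul_exp_abs w).trans ?_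
    set r := (X ω ^ 2 + v) / c with hr
    have hr0 : 0 ≤ r := by positivity
    have hw : |w| ≤ (|θ| * c) * r := by
      have : |X ω ^ 2 - v| ≤ X ω ^ 2 + v := by
        rw [abs_le]; constructor <;> linarith [sq_nonneg (X ω)]
      calc |w| = |θ| * |X ω ^ 2 - v| := abs_mul _ _
        _ ≤ |θ| * (X ω ^ 2 + v) := by gcongr
        _ = (|θ| * c) * r := by rw [hr]; field_simp
    have h1 : w ^ 2 ≤ (θ * c) ^ 2 * r ^ 2 := by
      calc w ^ 2 = |w| ^ 2 := (sq_abs _).symm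
        _ ≤ ((|θ| * c) * r) ^ 2 := by gcongr
        _ = _ := by rw [mul_pow, mul_pow, sq_abs]; ring
    have h2 : Real.exp |w| ≤ Real.exp (r / 16) := by
      apply Real.exp_le_exp.2
      nlinarith
    have h3 : r ^ 2 ≤ 512 * Real.exp (r / 16) := by
      have := Real.quadratic_le_exp_of_nonneg (show 0 ≤ r / 16 by positivity)
      nlinarith
    have h4 : Real.exp (r / 16) * Real.exp (r / 16) ≤ 3 * Real.exp (X ω ^ 2 / (8 * c)) := by
      rw [← Real.exp_add, show r / 16 + r / 16 = v / (8 * c) + X ω ^ 2 / (8 * c) by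
        rw [hr]; field_simp; ring, Real.exp_add]
      gcongr
    have : w ^ 2 * Real.exp |w| ≤ 1536 * (θ * c) ^ 2 * Real.exp (X ω ^ 2 / (8 * c)) := by
      calc w ^ 2 * Real.exp |w| ≤ ((θ * c) ^ 2 * r ^ 2) * Real.exp (r / 16) := by gcongr
        _ ≤ ((θ * c) ^ 2 * (512 * Real.exp (r / 16))) * Real.exp (r / 16) := by gcongr
        _ = 512 * (θ * c) ^ 2 * (Real.exp (r / 16) * Real.exp (r / 16)) := by ring
        _ ≤ 512 * (θ * c) ^ 2 * (3 * Real.exp (X ω ^ 2 / (8 * c))) := by gcongr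
        _ = _ := by ring
    linarith
  have hI : Integrable (fun ω => 1 + θ * (X ω ^ 2 - v)) P :=
    (integrable_const _).add ((hsq.sub (integrable_const _)).const_mul _)
  have hI' : Integrable (fun ω => 1 + θ * (X ω ^ 2 - v) +
      1536 * (θ * c) ^ 2 * Real.exp (X ω ^ 2 / (8 * c))) P := hI.add (hi.const_mul _)
  have hint : Integrable (fun ω => Real.exp (θ * (X ω ^ 2 - v))) P := by
    refine hI'.mono' (by fun_prop) (ae_of_all _ fun ω => ?_)
    rw [Real.norm_eq_abs, Real.abs_exp]
    exact key ω
  refine ⟨hint, (integral_mono hint hI' key).trans ?_⟩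
  have hI1 : ∫ ω, (1 + θ * (X ω ^ 2 - v)) ∂P = 1 := by
    have h1 : Integrable (fun ω => X ω ^ 2 - v) P := hsq.sub (integrable_const _)
    rw [integral_add (integrable_const _) (h1.const_mul _), integral_const_mul,
      integral_sub hsq (integrable_const _), hv]
    simp
  rw [integral_add hI (hi.const_mul _), integral_const_mul, hI1]
  have : 1536 * (θ * c) ^ 2 * ∫ ω, Real.exp (X ω ^ 2 / (8 * c)) ∂P ≤ 3072 * (θ * c) ^ 2 := by
    nlinarith [sq_nonneg (θ * c)]
  linarith [Real.add_one_le_exp (3072 * (θ * c) ^ 2)]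

/-- The exponent in Bernstein's inequality. -/
theorem exists_bernstein_exponent {γ : ℝ} (hγ : 0 < γ) :
    ∃ t : ℝ, 0 < t ∧ t ≤ 1 / 16 ∧
      -(t * γ) + 3072 * t ^ 2 ≤ -min (γ ^ 2 / 112 ^ 2) (γ / 112) := by
  -- The unconstrained minimizer `γ/6144` gives the value `-γ²/12288`, and `12288 ≤ 112²`. Otherwise
  -- `γ ≥ 384`, and `t = 1/16` gives `-γ/16 + 12 ≤ -γ/32`.
  rcases le_total (γ / 6144) (1 / 16) with h | h
  · refine ⟨γ / 6144, by positivity, h, ?_⟩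
    have := min_le_left (γ ^ 2 / 112 ^ 2) (γ / 112)
    nlinarith [sq_nonneg γ]
  · refine ⟨1 / 16, by norm_num, le_rfl, ?_⟩
    have := min_le_right (γ ^ 2 / 112 ^ 2) (γ / 112)
    nlinarith

/-- A Chernoff bound. -/
theorem measure_ge_le_of_integral_exp_le [IsProbabilityMeasure P] {Y : Ω → ℝ} {θ a b : ℝ}
    (hint : Integrable (fun ω => Real.exp (θ * Y ω)) P)
    (hle : ∫ ω, Real.exp (θ * Y ω) ∂P ≤ Real.exp b) :
    P {ω | a ≤ θ * Y ω} ≤ ENNReal.ofReal (Real.exp (-a + b)) := by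
  have h1 := mul_meas_ge_le_integral_of_nonneg (μ := P)
    (f := fun ω => Real.exp (θ * Y ω)) (ae_of_all _ fun ω => by positivity) hint (Real.exp a)
  have h2 : P.real {ω | a ≤ θ * Y ω} ≤ Real.exp (-a + b) := by
    simp only [Real.exp_le_exp] at h1
    rw [Real.exp_add, Real.exp_neg, inv_mul_eq_div, le_div_iff₀ (Real.exp_pos _), mul_comm]
    exact h1.trans hle
  rw [← ofReal_measureReal]
  exact ENNReal.ofReal_le_ofReal h2

/-- Concentration of a sum of squares of (possibly dependent) subgaussian random variables, each
with its variance as subgaussian parameter. -/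
theorem measure_sum_sq_gt_le [IsProbabilityMeasure P] {ι : Type*} [Fintype ι]
    {z : ι → Ω → ℝ} {c : ι → ℝ≥0} (hz : ∀ i, Measurable (z i))
    (h : ∀ i, HasSubgaussianMGF (z i) (c i) P) (hv : ∀ i, ∫ ω, z i ω ^ 2 ∂P = c i)
    {V γ : ℝ} (hV : ∑ i, (c i : ℝ) ≤ V) (hγ : 0 < γ) :
    P {ω | (1 + γ) * V < ∑ i, z i ω ^ 2} ≤
      ENNReal.ofReal (Real.exp (-min (γ ^ 2 / 112 ^ 2) (γ / 112))) := by
  -- Variables with parameter 0 vanish almost surely. This makes the convention `t / 0 = 0` harmless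
  -- below.
  have hzero : ∀ᵐ ω ∂P, ∀ i, c i = 0 → z i ω = 0 := by
    rw [ae_all_iff]
    intro i
    by_cases hi : c i = 0
    · have := h i
      rw [hi] at this
      filter_upwards [this.ae_eq_zero_of_hasSubgaussianMGF_zero] with ω hω _ using hω
    · exact ae_of_all _ fun ω hi' => absurd hi' hi
  set U : ℝ := ∑ i, (c i : ℝ) with hU
  have hU0 : 0 ≤ U := Finset.sum_nonneg fun i _ => (c i).2
  rcases hU0.eq_or_lt with hU0 | hUpos
  · have hc : ∀ i, c i = 0 := by
      intro i
      have := (Finset.sum_eq_zero_iff_of_nonneg (fun i _ => (c i).2)).1 hU0.symm i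
        (Finset.mem_univ i)
      exact NNReal.coe_eq_zero.1 this
    refine le_of_eq_of_le ?_ zero_le
    rw [measure_eq_zero_iff_ae_notMem]
    filter_upwards [hzero] with ω hω
    simp only [not_lt]
    rw [Finset.sum_eq_zero fun i _ => by rw [hω i (hc i)]; ring]
    have : 0 ≤ V := hU0.le.trans hV
    positivity
  obtain ⟨t, ht0, ht, hexp⟩ := exists_bernstein_exponent hγ
  -- Jensen replaces independence: the normalized sum is the convex combination, with weights `c i /
  -- U`, of the exponents on the right, so its exponential is at most `F`, whose terms are
  -- integrated one at a time.
  let F : Ω → ℝ := fun ω => ∑ i, (c i : ℝ) / U * Real.exp (t / c i * (z i ω ^ 2 - c i))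
  have hF : ∀ i, Integrable (fun ω => (c i : ℝ) / U * Real.exp (t / c i * (z i ω ^ 2 - c i))) P ∧
      ∫ ω, (c i : ℝ) / U * Real.exp (t / c i * (z i ω ^ 2 - c i)) ∂P ≤
        (c i : ℝ) / U * Real.exp (3072 * t ^ 2) := by
    intro i
    rcases eq_or_lt_of_le (show 0 ≤ c i from zero_le) with hi | hi
    · simp [← hi]
    · have hi' : (0 : ℝ) < c i := hi
      have hti : t / c i * c i = t := by field_simp
      obtain ⟨h1, h2⟩ := integral_exp_centered_sq_le (hz i) (h i) hi (hv i) (θ := t / c i)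
        (by rw [abs_of_pos (by positivity), hti]; exact ht)
      rw [hti] at h2
      refine ⟨h1.const_mul _, ?_⟩
      rw [integral_const_mul]
      gcongr
  have hFint : Integrable F P := integrable_finsetSum _ fun i _ => (hF i).1
  have hFle : ∫ ω, F ω ∂P ≤ Real.exp (3072 * t ^ 2) := by
    simp only [F]
    rw [integral_finsetSum _ fun i _ => (hF i).1]
    refine (Finset.sum_le_sum fun i _ => (hF i).2).trans_eq ?_
    rw [← Finset.sum_mul, ← Finset.sum_div, ← hU, div_self hUpos.ne', one_mul]
  have hFge : ∀ᵐ ω ∂P, Real.exp (t * ((∑ i, z i ω ^ 2) / U - 1)) ≤ F ω := by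
    filter_upwards [hzero] with ω hω
    have hj := convexOn_exp.map_sum_le (t := Finset.univ) (w := fun i => (c i : ℝ) / U)
      (p := fun i => t / c i * (z i ω ^ 2 - c i)) (fun i _ => by positivity)
      (by rw [← Finset.sum_div, ← hU, div_self hUpos.ne']) (fun i _ => Set.mem_univ _)
    refine le_of_eq_of_le ?_ hj
    congr 1
    have : ∀ i, ((c i : ℝ) / U) • (t / c i * (z i ω ^ 2 - c i)) = t / U * (z i ω ^ 2 - c i) := by
      intro i
      rcases eq_or_ne (c i) 0 with hi | hi
      · simp [hi, hω i hi]
      · have : (c i : ℝ) ≠ 0 := by exact_mod_cast hi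
        simp only [smul_eq_mul]
        field_simp
    simp_rw [this]
    rw [← Finset.mul_sum, Finset.sum_sub_distrib, ← hU]
    field_simp
  have hE : Integrable (fun ω => Real.exp (t * ((∑ i, z i ω ^ 2) / U - 1))) P := by
    refine hFint.mono' (by fun_prop) ?_
    filter_upwards [hFge] with ω hω
    rwa [Real.norm_eq_abs, Real.abs_exp]
  refine (measure_mono fun ω hω => ?_).trans ((measure_ge_le_of_integral_exp_le (a := t * γ) hE
    ((integral_mono_ae hE hFint hFge).trans hFle)).trans
    (ENNReal.ofReal_le_ofReal (Real.exp_le_exp.2 hexp)))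
  simp only [Set.mem_ofPred_eq] at hω ⊢
  gcongr
  rw [le_sub_iff_add_le, le_div_iff₀ hUpos]
  nlinarith

end

section

open scoped NNReal ENNReal

/-! ### Concentration for matrices with i.i.d. subgaussian entries -/

theorem measurePreserving_uncurry_pi {ι κ α : Type*} [Fintype ι] [Fintype κ]
    [MeasurableSpace α] (ν : Measure α) [SigmaFinite ν] :
    MeasurePreserving (fun (b : ι → κ → α) (p : ι × κ) => b p.1 p.2)
      (Measure.pi fun _ => Measure.pi fun _ => ν) (Measure.pi fun _ => ν) := by
  refine ⟨by fun_prop, (Measure.pi_eq fun s hs => ?_).symm⟩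
  rw [Measure.map_apply (by fun_prop) (MeasurableSet.univ_pi hs)]
  have : (fun (b : ι → κ → α) (p : ι × κ) => b p.1 p.2) ⁻¹' Set.univ.pi s =
      Set.univ.pi fun i => Set.univ.pi fun j => s (i, j) := by
    ext b
    simp
  rw [this, Measure.pi_pi]
  simp_rw [Measure.pi_pi]
  rw [Fintype.prod_prod_type]

variable {c₀ : ℝ} {M N : ℕ} {ν : Measure ℝ}

/-- The factor 2 in the parameter is a matter of convention: `HasSubgaussianMGF` bounds the moment
generating function by `exp (c t²/2)`. -/
theorem IsSubgaussianEntryLaw.hasSubgaussianMGF_id (h : IsSubgaussianEntryLaw c₀ M ν) :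
    HasSubgaussianMGF id (2 * c₀ ^ 2 / M).toNNReal ν where
  integrable_exp_mul t := by
    simpa only [id, mul_comm] using (h.mgf_le t).1
  mgf_le t := by
    have := (h.mgf_le t).2
    simp only [mgf, id]
    simp only [mul_comm] at this ⊢
    refine this.trans_eq ?_
    rw [Real.coe_toNNReal _ (by positivity)]
    congr 1
    ring

theorem IsSubgaussianEntryLaw.hasSubgaussianMGF_row (h : IsSubgaussianEntryLaw c₀ M ν)
    (u : Fin N → ℝ) :
    HasSubgaussianMGF (fun b : Fin N → ℝ => ∑ n, b n * u n)
      (2 * c₀ ^ 2 / M * ∑ n, u n ^ 2).toNNReal (Measure.pi fun _ => ν) := by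
  have := h.isProbabilityMeasure
  have h1 : ∀ n, HasSubgaussianMGF (fun b : Fin N → ℝ => u n * b n) _
      (Measure.pi fun _ => ν) := fun n => HasSubgaussianMGF.const_mul
    (X := fun b : Fin N → ℝ => b n) (c := (2 * c₀ ^ 2 / M).toNNReal) (by
      have hm := (measurePreserving_eval (fun _ : Fin N => ν) n)
      have := h.hasSubgaussianMGF_id
      rw [← hm.map_eq] at this
      exact HasSubgaussianMGF.of_map hm.measurable.aemeasurable this) (u n)
  have h2 := HasSubgaussianMGF.sum_of_iIndepFun (s := Finset.univ)
    (iIndepFun_pi (μ := fun _ : Fin N => ν) (X := fun n x => u n * x)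
      (fun n => by fun_prop)) (fun n _ => h1 n)
  convert! h2 using 1
  · ext b; simp only [mul_comm]
  · rw [← NNReal.coe_inj, Real.coe_toNNReal _ (by positivity)]
    push_cast
    rw [Finset.mul_sum]
    refine Finset.sum_congr rfl fun n _ => ?_
    change _ = u n ^ 2 * ((2 * c₀ ^ 2 / M).toNNReal : ℝ)
    rw [Real.coe_toNNReal _ (by positivity), mul_comm]

theorem IsSubgaussianEntryLaw.integral_row_sq (h : IsSubgaussianEntryLaw c₀ M ν)
    (u : Fin N → ℝ) :
    ∫ b : Fin N → ℝ, (∑ n, b n * u n) ^ 2 ∂(Measure.pi fun _ => ν) = (∑ n, u n ^ 2) / M := by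
  have := h.isProbabilityMeasure
  have hm : MemLp (fun x : ℝ => x) 2 ν := h.hasSubgaussianMGF_id.memLp 2
  have h1 := variance_sum_pi (μ := fun _ : Fin N => ν) (X := fun n x => x * u n)
    (fun n => hm.mul_const _)
  have e : (∑ n, fun ω : Fin N → ℝ => ω n * u n) = fun b => ∑ n, b n * u n := by
    ext b; simp
  have hint : ∀ n : Fin N, Integrable (fun b : Fin N → ℝ => b n) (Measure.pi fun _ => ν) :=
    fun n => (measurePreserving_eval (fun _ : Fin N => ν) n).integrable_comp_of_integrable
      h.mean_zero.1
  have hz : ∀ n : Fin N, ∫ b : Fin N → ℝ, b n ∂(Measure.pi fun _ => ν) = 0 := by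
    intro n
    rw [← h.mean_zero.2]
    exact integral_comp_eval (μ := fun _ : Fin N => ν) (f := fun x : ℝ => x) (by fun_prop)
  rw [e, variance_of_integral_eq_zero (Measurable.aemeasurable (by fun_prop))] at h1
  · rw [h1, Finset.sum_div]
    refine Finset.sum_congr rfl fun n _ => ?_
    simp_rw [mul_comm _ (u n)]
    rw [variance_const_mul, variance_of_integral_eq_zero (by fun_prop) h.mean_zero.2,
      h.variance.2]
    ring
  · rw [integral_finsetSum _ fun n _ => (hint n).mul_const _]
    refine Finset.sum_eq_zero fun n _ => ?_
    rw [integral_mul_const, hz, zero_mul]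

theorem integrable_prod_and_integral_le {β κ : Type*} [MeasurableSpace β] [Fintype κ]
    {μ : Measure β} [SigmaFinite μ] {f : β → ℝ} {B : ℝ} (hf0 : ∀ b, 0 ≤ f b)
    (hf : Integrable f μ) (hB : ∫ b, f b ∂μ ≤ B) :
    Integrable (fun b : κ → β => ∏ m, f (b m)) (Measure.pi fun _ => μ) ∧
      ∫ b : κ → β, ∏ m, f (b m) ∂(Measure.pi fun _ => μ) ≤ B ^ Fintype.card κ := by
  refine ⟨Integrable.fintype_prod (f := fun _ => f) fun _ => hf, ?_⟩
  rw [integral_fintype_prod_eq_prod (f := fun _ => f), Finset.prod_const, Finset.card_univ]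
  exact pow_le_pow_left₀ (integral_nonneg hf0) hB _

/-- Chernoff bound over the `M` independent rows; the sign `s` selects the upper or the lower tail.
A row has subgaussian parameter `2c₀²` times its variance, so the deviation `η` enters as
`η/(2c₀²)`. -/
theorem IsSubgaussianEntryLaw.measure_sum_sq_dev_le (h : IsSubgaussianEntryLaw c₀ M ν)
    (hc₀ : 0 < c₀) (hM : 0 < M) (u : Fin N → ℝ) (hu : 0 < ∑ n, u n ^ 2) {η : ℝ} (hη : 0 < η)
    {s : ℝ} (hs : |s| = 1) :
    (Measure.pi fun _ : Fin M × Fin N => ν)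
      {a | η * ∑ n, u n ^ 2 ≤ s * (∑ m, (∑ n, a (m, n) * u n) ^ 2 - ∑ n, u n ^ 2)} ≤
      ENNReal.ofReal (Real.exp (-min ((η / (2 * c₀ ^ 2)) ^ 2 / 112 ^ 2)
        (η / (2 * c₀ ^ 2) / 112) * M)) := by
  have := h.isProbabilityMeasure
  set U := ∑ n, u n ^ 2
  have hM' : (0 : ℝ) < M := by exact_mod_cast hM
  obtain ⟨t, ht0, ht, hexp⟩ := exists_bernstein_exponent (γ := η / (2 * c₀ ^ 2)) (by positivity)
  set c : ℝ := 2 * c₀ ^ 2 / M * U with hc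
  have hc0 : 0 < c := by positivity
  obtain ⟨hi, hle⟩ := integral_exp_centered_sq_le (by fun_prop) (h.hasSubgaussianMGF_row u)
    (Real.toNNReal_pos.2 hc0) (h.integral_row_sq u) (θ := s * t / c) (by
      rw [Real.coe_toNNReal _ hc0.le, abs_div, abs_mul, hs, abs_of_pos ht0, abs_of_pos hc0]
      field_simp
      linarith)
  rw [Real.coe_toNNReal _ hc0.le, div_mul_cancel₀ _ hc0.ne'] at hle
  have hst : (s * t) ^ 2 = t ^ 2 := by rw [← sq_abs, abs_mul, hs, one_mul, sq_abs]
  rw [hst] at hle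
  rw [← (measurePreserving_uncurry_pi (ι := Fin M) (κ := Fin N) ν).measure_preimage
    (by apply MeasurableSet.nullMeasurableSet; apply measurableSet_le <;> fun_prop)]
  have hprod : ∀ b : Fin M → Fin N → ℝ,
      Real.exp (s * t / c * (∑ m, (∑ n, b m n * u n) ^ 2 - U)) =
        ∏ m, Real.exp (s * t / c * ((∑ n, b m n * u n) ^ 2 - U / M)) := by
    intro b
    rw [← Real.exp_sum, ← Finset.mul_sum, Finset.sum_sub_distrib]
    simp
    field_simp
    simp
  obtain ⟨hint, hint'⟩ := integrable_prod_and_integral_le (κ := Fin M)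
    (fun b => (Real.exp_pos _).le) hi hle
  rw [Fintype.card_fin, ← Real.exp_nat_mul] at hint'
  have hF := funext hprod
  rw [← hF] at hint
  rw [← integral_congr_ae (ae_of_all _ hprod)] at hint'
  refine (measure_mono fun b hb => ?_).trans ((measure_ge_le_of_integral_exp_le
    (a := t * (η / (2 * c₀ ^ 2)) * M) hint hint').trans
    (ENNReal.ofReal_le_ofReal (Real.exp_le_exp.2 ?_)))
  · simp only [Set.mem_preimage, Set.mem_ofPred_eq] at hb ⊢
    calc t * (η / (2 * c₀ ^ 2)) * M = t / c * (η * U) := by rw [hc]; field_simp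
      _ ≤ t / c * (s * (∑ m, (∑ n, b m n * u n) ^ 2 - U)) := by gcongr
      _ = _ := by ring
  · nlinarith

/-- The concentration constant of matrices with subgaussian entries. -/
def subgaussianConcentration (c₀ η : ℝ) : ℝ :=
  min ((η / (2 * c₀ ^ 2)) ^ 2 / 112 ^ 2) (η / (2 * c₀ ^ 2) / 112)

theorem norm_applyMatrix_sq (A : Matrix (Fin M) (Fin N) ℝ) (x : EuclideanSpace ℂ (Fin N)) :
    ‖applyMatrix A x‖ ^ 2 = ∑ m, (∑ n, A m n * (x n).re) ^ 2 + ∑ m, (∑ n, A m n * (x n).im) ^ 2 := by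
  rw [EuclideanSpace.norm_sq_eq, ← Finset.sum_add_distrib]
  refine Finset.sum_congr rfl fun m _ => ?_
  rw [← Complex.normSq_eq_norm_sq, Complex.normSq_apply]
  simp [applyMatrix, Matrix.mulVec, dotProduct, sq]

theorem norm_sq_eq_sum_re_add_sum_im (x : EuclideanSpace ℂ (Fin N)) :
    ‖x‖ ^ 2 = ∑ n, (x n).re ^ 2 + ∑ n, (x n).im ^ 2 := by
  rw [EuclideanSpace.norm_sq_eq, ← Finset.sum_add_distrib]
  refine Finset.sum_congr rfl fun m _ => ?_
  rw [← Complex.normSq_eq_norm_sq, Complex.normSq_apply]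
  ring

/-- The condition `0 < ∑ n, u n ^ 2` empties the event for `u = 0`, so that the bound also serves
complex vectors whose real or imaginary part vanishes. -/
theorem IsSubgaussianEntryLaw.measure_real_dev_le (h : IsSubgaussianEntryLaw c₀ M ν)
    (hc₀ : 0 < c₀) (hM : 0 < M) (u : Fin N → ℝ) {η : ℝ} (hη : 0 < η) :
    (Measure.pi fun _ : Fin M × Fin N => ν)
      {a | 0 < ∑ n, u n ^ 2 ∧
        η * ∑ n, u n ^ 2 ≤ |∑ m, (∑ n, a (m, n) * u n) ^ 2 - ∑ n, u n ^ 2|} ≤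
      ENNReal.ofReal (2 * Real.exp (-subgaussianConcentration c₀ η * M)) := by
  by_cases hu : 0 < ∑ n, u n ^ 2
  · have h1 := h.measure_sum_sq_dev_le hc₀ hM u hu hη (s := 1) (by simp)
    have h2 := h.measure_sum_sq_dev_le hc₀ hM u hu hη (s := -1) (by simp)
    rw [two_mul, ENNReal.ofReal_add (by positivity) (by positivity)]
    refine (measure_mono fun a ha => ?_).trans ((measure_union_le _ _).trans (add_le_add h1 h2))
    rcases le_abs.1 ha.2 with h' | h'
    · left; simpa using h'
    · right; simpa using h'
  · simp [hu]

theorem isConcentrationConstant_subgaussianConcentration (hc₀ : 0 < c₀)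
    (h : IsSubgaussianEntryLaw c₀ M ν) :
    IsConcentrationConstant M N ν (subgaussianConcentration c₀) := by
  intro η hη
  have := h.isProbabilityMeasure
  refine ⟨lt_min (by positivity) (by positivity), fun x hx => ?_⟩
  rcases Nat.eq_zero_or_pos M with rfl | hM
  · refine prob_le_one.trans ?_
    simp
  have h1 := h.measure_real_dev_le hc₀ hM (fun n => (x n).re) hη
  have h2 := h.measure_real_dev_le hc₀ hM (fun n => (x n).im) hη
  rw [show (4 : ℝ) = 2 + 2 by norm_num, add_mul, ENNReal.ofReal_add (by positivity)
    (by positivity)]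
  refine (measure_mono fun a ha => ?_).trans ((measure_union_le _ _).trans (add_le_add h1 h2))
  simp only [Set.mem_ofPred_eq, norm_applyMatrix_sq, Matrix.of_apply] at ha
  have hpos : 0 < ‖x‖ ^ 2 := by positivity
  rw [norm_sq_eq_sum_re_add_sum_im] at ha hpos
  -- As `A` is real, real and imaginary parts decouple. If both deviate by less than the fraction
  -- `η`, so does the sum; the two failure probabilities make up `4 = 2 + 2`.
  by_contra hcon
  simp only [Set.mem_union, Set.mem_ofPred_eq, not_or, not_and, not_le] at hcon
  obtain ⟨k1, k2⟩ := hcon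
  have p1 : 0 ≤ ∑ n, (x n).re ^ 2 := by positivity
  have p2 : 0 ≤ ∑ n, (x n).im ^ 2 := by positivity
  have z : ∀ u : Fin N → ℝ, ∑ n, u n ^ 2 = 0 →
      |∑ m, (∑ n, a (m, n) * u n) ^ 2 - ∑ n, u n ^ 2| = 0 := by
    intro u hu
    have : ∀ n, u n = 0 := fun n => by
      have := (Finset.sum_eq_zero_iff_of_nonneg (fun i _ => sq_nonneg (u i))).1 hu n
        (Finset.mem_univ n)
      exact pow_eq_zero_iff (two_ne_zero) |>.1 this
    simp [this]
  have tri := abs_add_le (∑ m, (∑ n, a (m, n) * (x n).re) ^ 2 - ∑ n, (x n).re ^ 2)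
    (∑ m, (∑ n, a (m, n) * (x n).im) ^ 2 - ∑ n, (x n).im ^ 2)
  rw [show ∀ p q r t : ℝ, p - q + (r - t) = p + r - (q + t) by intros; ring] at tri
  rcases p1.eq_or_lt with e1 | e1 <;> rcases p2.eq_or_lt with e2 | e2
  · linarith
  · have : η * ∑ n, (x n).re ^ 2 = 0 := by rw [← e1, mul_zero]
    have := z _ e1.symm
    have := k2 e2
    linarith
  · have : η * ∑ n, (x n).im ^ 2 = 0 := by rw [← e2, mul_zero]
    have := z _ e2.symm
    have := k1 e1
    linarith
  · have := k1 e1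
    have := k2 e2
    linarith

end

/-! ### Convergence of block-based iterative hard thresholding -/

/-- `applyMatrix A` as a linear map. -/
def applyMatrixLin {M N : ℕ} (A : Matrix (Fin M) (Fin N) ℝ) :
    EuclideanSpace ℂ (Fin N) →ₗ[ℂ] EuclideanSpace ℂ (Fin M) where
  toFun := applyMatrix A
  map_add' x y := by simp [applyMatrix, Matrix.mulVec_add]
  map_smul' c x := by simp [applyMatrix, Matrix.mulVec_smul]

theorem applyMatrixLin_apply {M N : ℕ} (A : Matrix (Fin M) (Fin N) ℝ)
    (x : EuclideanSpace ℂ (Fin N)) : applyMatrixLin A x = applyMatrix A x := rfl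

theorem inner_applyMatrix_transpose {M N : ℕ} (A : Matrix (Fin M) (Fin N) ℝ)
    (x : EuclideanSpace ℂ (Fin N)) (y : EuclideanSpace ℂ (Fin M)) :
    inner ℂ x (applyMatrix Aᵀ y) = inner ℂ (applyMatrix A x) y := by
  simp only [applyMatrix, PiLp.inner_apply, RCLike.inner_apply, Matrix.mulVec, dotProduct,
    Matrix.map_apply, Matrix.transpose_apply, map_sum, map_mul, Complex.conj_ofReal,
    Finset.sum_mul, Finset.mul_sum]
  rw [Finset.sum_comm]
  refine Finset.sum_congr rfl fun m _ => Finset.sum_congr rfl fun n _ => by ring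

/-- One step of projected gradient descent: if `p` is at least as close to the gradient step from
`w` as `q`, then the residual at `p` is controlled by the residual at `q`. -/
theorem norm_residual_sq_le_of_gradient_step {E F : Type*}
    [NormedAddCommGroup E] [InnerProductSpace ℂ E] [NormedAddCommGroup F] [InnerProductSpace ℂ F]
    {L : E →ₗ[ℂ] F} {L' : F → E} (hL : ∀ x y, inner ℂ x (L' y) = inner ℂ (L x) y)
    {μ : ℝ} (hμ : 0 < μ) {w p q : E} {y : F}
    (hpq : ‖w + (μ : ℂ) • L' (y - L w) - p‖ ≤ ‖w + (μ : ℂ) • L' (y - L w) - q‖)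
    (hp : ‖L (w - p)‖ ^ 2 ≤ 1 / μ * ‖w - p‖ ^ 2) :
    ‖y - L p‖ ^ 2 ≤ ‖y - L q‖ ^ 2 + 1 / μ * ‖w - q‖ ^ 2 - ‖L (w - q)‖ ^ 2 := by
  set g := L' (y - L w)
  have h1 : ∀ z, ‖w + (μ : ℂ) • g - z‖ ^ 2 =
      ‖w - z‖ ^ 2 + 2 * (μ * (inner ℂ (L (w - z)) (y - L w)).re) + (μ * ‖g‖) ^ 2 := by
    intro z
    rw [show w + (μ : ℂ) • g - z = (w - z) + (μ : ℂ) • g by abel, norm_add_sq (𝕜 := ℂ),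
      inner_smul_right, hL, norm_smul]
    simp [abs_of_pos hμ]
  have h2 : ∀ z, ‖y - L z‖ ^ 2 =
      ‖L (w - z)‖ ^ 2 + 2 * (inner ℂ (L (w - z)) (y - L w)).re + ‖y - L w‖ ^ 2 := by
    intro z
    rw [show y - L z = L (w - z) + (y - L w) by rw [map_sub]; abel, norm_add_sq (𝕜 := ℂ)]
    rfl
  have h3 := pow_le_pow_left₀ (norm_nonneg _) hpq 2
  rw [h1, h1] at h3
  rw [h2 p, h2 q]
  -- The distance to the gradient step and the residual contain the same cross term. Scaling by
  -- `1/μ` aligns them, and `hp` then lets `1/μ * ‖w - p‖²` dominate `‖L (w - p)‖²`.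
  have h4 : 1 / μ * (‖w - p‖ ^ 2 + 2 * (μ * (inner ℂ (L (w - p)) (y - L w)).re)) ≤
      1 / μ * (‖w - q‖ ^ 2 + 2 * (μ * (inner ℂ (L (w - q)) (y - L w)).re)) := by
    gcongr 1 / μ * ?_
    linarith
  have h5 : ∀ r s : ℝ, 1 / μ * (r + 2 * (μ * s)) = 1 / μ * r + 2 * s := by
    intro r s; field_simp
  rw [h5, h5] at h4
  linarith

section

variable {N J k : ℕ} {Ψ : Matrix (Fin N) (Fin J × Fin k) ℂ}

theorem blockRange_mono {S S' : Finset (Fin J)} (h : S ⊆ S') :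
    blockRange Ψ S ≤ blockRange Ψ S' :=
  Submodule.span_mono fun _ ⟨i, hi, l, hv⟩ => ⟨i, h hi, l, hv⟩

theorem IsBlockProj.norm_sub_le {x z q : EuclideanSpace ℂ (Fin N)} {K : ℕ}
    (h : IsBlockProj Ψ x K z) {I : Finset (Fin J)} (hI : I.card ≤ K) (hq : q ∈ blockRange Ψ I) :
    ‖x - z‖ ≤ ‖x - q‖ := by
  obtain ⟨S, ⟨_, hS⟩, _, hz⟩ := h
  have h1 : ‖x - z‖ ≤ Metric.infDist x (blockRange Ψ S : Set (EuclideanSpace ℂ (Fin N))) :=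
    (Metric.le_infDist ⟨0, zero_mem _⟩).2 fun {w} hw => by
      rw [dist_eq_norm]; exact hz w hw
  have h2 := Metric.infDist_le_dist_of_mem (x := x) (SetLike.mem_coe.2 hq)
  rw [dist_eq_norm] at h2
  exact h1.trans ((hS I hI).trans h2)

variable {M K : ℕ} {A : Matrix (Fin M) (Fin N) ℝ}

/-- The restricted isometry property of `A` on unions of `n` blocks of `Ψ`. -/
def BlockRIP (A : Matrix (Fin M) (Fin N) ℝ) (Ψ : Matrix (Fin N) (Fin J × Fin k) ℂ)
    (n : ℕ) (δ : ℝ) : Prop :=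
  ∀ S : Finset (Fin J), S.card ≤ n → ∀ v ∈ blockRange Ψ S,
    (1 - δ) * ‖v‖ ^ 2 ≤ ‖applyMatrix A v‖ ^ 2 ∧ ‖applyMatrix A v‖ ^ 2 ≤ (1 + δ) * ‖v‖ ^ 2

/-- A difference of two vectors on `K` blocks each lives on at most `2K` blocks; hence the order
`2K`. -/
theorem BlockRIP.sub {δ : ℝ} (h : BlockRIP A Ψ (2 * K) δ) {S S' : Finset (Fin J)}
    (hS : S.card ≤ K) (hS' : S'.card ≤ K) {v w : EuclideanSpace ℂ (Fin N)}
    (hv : v ∈ blockRange Ψ S) (hw : w ∈ blockRange Ψ S') :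
    (1 - δ) * ‖v - w‖ ^ 2 ≤ ‖applyMatrix A (v - w)‖ ^ 2 ∧
      ‖applyMatrix A (v - w)‖ ^ 2 ≤ (1 + δ) * ‖v - w‖ ^ 2 := by
  classical
  refine h (S ∪ S') ((Finset.card_union_le _ _).trans (by omega)) _ (sub_mem ?_ ?_)
  · exact blockRange_mono Finset.subset_union_left hv
  · exact blockRange_mono Finset.subset_union_right hw

theorem IsBlockIHT.exists_mem_blockRange {μ : ℝ} {y : EuclideanSpace ℂ (Fin M)}
    {u : ℕ → EuclideanSpace ℂ (Fin N)} (hu : IsBlockIHT A Ψ K μ y u) (n : ℕ) :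
    ∃ S : Finset (Fin J), S.card ≤ K ∧ u n ∈ blockRange Ψ S := by
  cases n with
  | zero => exact ⟨∅, by simp, by rw [hu.1]; exact zero_mem _⟩
  | succ n =>
    obtain ⟨S, hS, h, _⟩ := hu.2 n
    exact ⟨S, hS.1, h⟩

theorem convergenceRate_mem_Icc {δ μ : ℝ} (hδ0 : 0 < δ) (hδ : δ < 0.2) (hμ1 : 1 + δ ≤ 1 / μ)
    (hμ2 : 1 / μ < 1.5 * (1 - δ)) :
    1 / (μ * (1 - δ)) - 1 ∈ Set.Icc (0 : ℝ) (1 / 2) := by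
  have hμ : 0 < μ := one_div_pos.1 (by linarith)
  have h1 : 1 / (μ * (1 - δ)) = 1 / μ / (1 - δ) := (div_div _ _ _).symm
  rw [h1]
  constructor
  · rw [sub_nonneg, le_div_iff₀ (by linarith)]
    linarith
  · rw [sub_le_iff_le_add, div_le_iff₀ (by linarith)]
    linarith

/-- Linear convergence of block-based iterative hard thresholding to a neighbourhood of the
block-sparse part `x'` of the signal `xs`. -/
theorem IsBlockIHT.norm_sub_le {δ μ : ℝ} (hδ0 : 0 < δ) (hδ : δ < 0.2) (hμ1 : 1 + δ ≤ 1 / μ)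
    (hμ2 : 1 / μ < 1.5 * (1 - δ)) (hRIP : BlockRIP A Ψ (2 * K) δ) {I : Finset (Fin J)}
    (hI : I.card ≤ K) {xs x' : EuclideanSpace ℂ (Fin N)} (hx' : x' ∈ blockRange Ψ I)
    {u : ℕ → EuclideanSpace ℂ (Fin N)} (hu : IsBlockIHT A Ψ K μ (applyMatrix A xs) u) (n : ℕ) :
    ‖x' - u n‖ ≤ 2 * (√(1 / (μ * (1 - δ)) - 1) ^ n * ‖x'‖) + 8 * ‖applyMatrix A (xs - x')‖ := by
  have hμ : 0 < μ := one_div_pos.1 (by linarith)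
  set ρ := 1 / (μ * (1 - δ)) - 1 with hρ
  set b := ‖applyMatrix A (xs - x')‖ with hb
  have hb0 : 0 ≤ b := norm_nonneg _
  have hρe : ρ * (1 - δ) = 1 / μ - (1 - δ) := by
    have : 1 - δ ≠ 0 := by linarith
    rw [hρ]; field_simp
  obtain ⟨hρ0, hρ1⟩ := convergenceRate_mem_Icc hδ0 hδ hμ1 hμ2
  rw [← hρ] at hρ0 hρ1
  have hsρ : √ρ ≤ 0.7072 := by
    rw [Real.sqrt_le_left (by norm_num)]
    linarith
  have hsub : ∀ n, (1 - δ) * ‖u n - x'‖ ^ 2 ≤ ‖applyMatrix A (u n - x')‖ ^ 2 ∧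
      ‖applyMatrix A (u n - x')‖ ^ 2 ≤ (1 + δ) * ‖u n - x'‖ ^ 2 := by
    intro n
    obtain ⟨S, hS, hmem⟩ := hu.exists_mem_blockRange n
    exact hRIP.sub hS hI hmem hx'
  have hstep : ∀ n, ‖applyMatrix A (u (n + 1) - x')‖ ≤
      2 * b + √ρ * ‖applyMatrix A (u n - x')‖ := by
    intro n
    set a := ‖applyMatrix A (u n - x')‖ with ha
    have ha0 : 0 ≤ a := norm_nonneg _
    obtain ⟨S, hS, hmem⟩ := hu.exists_mem_blockRange n
    obtain ⟨S', hS', hmem'⟩ := hu.exists_mem_blockRange (n + 1)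
    have h1 := norm_residual_sq_le_of_gradient_step (L := applyMatrixLin A)
      (L' := applyMatrix Aᵀ) (inner_applyMatrix_transpose A) hμ
      ((hu.2 n).norm_sub_le hI hx') (by
        refine (hRIP.sub hS hS' hmem hmem').2.trans ?_
        gcongr)
    rw [← applyMatrixLin_apply, ← map_sub, ← map_sub] at h1
    simp only [applyMatrixLin_apply] at h1
    rw [← hb, ← ha] at h1
    -- The lower isometry bound turns `1/μ = (1 + ρ)(1 - δ)` into the factor `1 + ρ` in front of
    -- `a²`.
    have h2 : 1 / μ * ‖u n - x'‖ ^ 2 - a ^ 2 ≤ ρ * a ^ 2 := by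
      have h3 := (hsub n).1
      rw [← ha] at h3
      have h4 : 1 / μ = (1 + ρ) * (1 - δ) := by linarith
      rw [h4]
      have := mul_le_mul_of_nonneg_left h3 (show 0 ≤ 1 + ρ by linarith)
      linarith
    have h5 : ‖applyMatrix A (xs - u (n + 1))‖ ≤ b + √ρ * a := by
      refine le_of_sq_le_sq ?_ (by positivity)
      have : (√ρ * a) ^ 2 = ρ * a ^ 2 := by rw [mul_pow, Real.sq_sqrt hρ0]
      have : 0 ≤ b * (√ρ * a) := by positivity
      nlinarith
    have h6 : applyMatrix A (u (n + 1) - x') =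
        applyMatrix A (xs - x') - applyMatrix A (xs - u (n + 1)) := by
      simp only [← applyMatrixLin_apply, ← map_sub]
      congr 1
      abel
    rw [h6]
    have := _root_.norm_sub_le (applyMatrix A (xs - x')) (applyMatrix A (xs - u (n + 1)))
    linarith
  -- The constant 7 exceeds the fixed point `2/(1 - √ρ)`, since `√ρ ≤ 0.7072`.
  have hgeom : ∀ n, ‖applyMatrix A (u n - x')‖ ≤
      √ρ ^ n * ‖applyMatrix A (u 0 - x')‖ + 7 * b := by
    intro n
    induction n with
    | zero => linarith
    | succ n ih =>
      refine (hstep n).trans ?_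
      have h1 := mul_le_mul_of_nonneg_left ih (Real.sqrt_nonneg ρ)
      have h2 := mul_le_mul_of_nonneg_right hsρ (show 0 ≤ 7 * b by positivity)
      rw [mul_add, ← mul_assoc, ← pow_succ'] at h1
      linarith
  -- For `δ < 0.2`, `√(1 + δ) ≤ 1.1` and `1/√(1 - δ) ≤ 1.12`. The final constants follow from `1.12
  -- * 1.1 ≤ 2` and `1.12 * 7 ≤ 8`.
  have h0 : ‖applyMatrix A (u 0 - x')‖ ≤ 1.1 * ‖x'‖ := by
    refine le_of_sq_le_sq ((hsub 0).2.trans ?_) (by positivity)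
    rw [hu.1, zero_sub, norm_neg]
    nlinarith [sq_nonneg ‖x'‖]
  have hlow : ‖u n - x'‖ ≤ 1.12 * ‖applyMatrix A (u n - x')‖ := by
    refine le_of_sq_le_sq ?_ (by positivity)
    nlinarith [(hsub n).1, sq_nonneg ‖u n - x'‖]
  have hp : 0 ≤ √ρ ^ n := by positivity
  have := mul_le_mul_of_nonneg_left h0 hp
  have h9 : 0 ≤ √ρ ^ n * ‖x'‖ := by positivity
  rw [norm_sub_rev]
  linarith [hgeom n]

end

/-! ### Nets of the unit sphere and the restricted isometry property -/

open Module in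
open scoped Function ENNReal in
-- Volume comparison: the balls of radius `ε/2` about the points are disjoint and lie in the ball of
-- radius `1 + ε/2`.
theorem card_le_of_separated_unitBall {E : Type*} [NormedAddCommGroup E] [NormedSpace ℝ E]
    [FiniteDimensional ℝ E] {ε : ℝ} (hε : 0 < ε) (s : Finset E) (hs : ∀ c ∈ s, ‖c‖ ≤ 1)
    (h : ∀ c ∈ s, ∀ d ∈ s, c ≠ d → ε ≤ ‖c - d‖) :
    (s.card : ℝ) ≤ (1 + 2 / ε) ^ finrank ℝ E := by
  borelize E
  let μ : Measure E := Measure.addHaar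
  let δ : ℝ := ε / 2
  let ρ : ℝ := 1 + ε / 2
  have ρpos : 0 < ρ := by positivity
  have δpos : 0 < δ := by positivity
  set A := ⋃ c ∈ s, Metric.ball (c : E) δ with hA
  have D : Set.Pairwise (s : Set E) (Disjoint on fun c => Metric.ball (c : E) δ) := by
    rintro c hc d hd hcd
    apply Metric.ball_disjoint_ball
    rw [dist_eq_norm]
    have := h c hc d hd hcd
    simp only [δ]
    linarith
  have A_subset : A ⊆ Metric.ball (0 : E) ρ := by
    refine Set.iUnion₂_subset fun x hx => ?_
    apply Metric.ball_subset_ball'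
    rw [dist_zero_right]
    simp only [δ, ρ]
    linarith [hs x hx]
  have I :
    (s.card : ℝ≥0∞) * ENNReal.ofReal (δ ^ finrank ℝ E) * μ (Metric.ball 0 1) ≤
      ENNReal.ofReal (ρ ^ finrank ℝ E) * μ (Metric.ball 0 1) :=
    calc
      (s.card : ℝ≥0∞) * ENNReal.ofReal (δ ^ finrank ℝ E) * μ (Metric.ball 0 1) = μ A := by
        rw [hA, measure_biUnion_finset D fun c _ => measurableSet_ball]
        simp only [μ.addHaar_ball_of_pos _ δpos]
        simp only [Finset.sum_const, nsmul_eq_mul, mul_assoc]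
      _ ≤ μ (Metric.ball (0 : E) ρ) := measure_mono A_subset
      _ = ENNReal.ofReal (ρ ^ finrank ℝ E) * μ (Metric.ball 0 1) := by
        simp only [μ.addHaar_ball_of_pos _ ρpos]
  have J : (s.card : ℝ≥0∞) * ENNReal.ofReal (δ ^ finrank ℝ E) ≤ ENNReal.ofReal (ρ ^ finrank ℝ E) :=
    (ENNReal.mul_le_mul_iff_left (Metric.measure_ball_pos _ _ zero_lt_one).ne'
      measure_ball_lt_top.ne).1 I
  have K := ENNReal.toReal_le_of_le_ofReal (pow_nonneg ρpos.le _) J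
  rw [ENNReal.toReal_mul, ENNReal.toReal_natCast, ENNReal.toReal_ofReal (by positivity),
    ← le_div_iff₀ (by positivity), ← div_pow] at K
  refine K.trans_eq ?_
  congr 1
  simp only [ρ, δ]
  field_simp
  ring

/-- The unit sphere of a finite-dimensional space has small nets. -/
theorem exists_net_unitSphere (E : Type*) [NormedAddCommGroup E] [NormedSpace ℝ E]
    [FiniteDimensional ℝ E] {ε : ℝ} (hε : 0 < ε) :
    ∃ s : Finset E, (∀ q ∈ s, ‖q‖ = 1) ∧ (∀ v, ‖v‖ = 1 → ∃ q ∈ s, ‖v - q‖ ≤ ε) ∧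
      (s.card : ℝ) ≤ (1 + 2 / ε) ^ Module.finrank ℝ E := by
  classical
  let Sep : Set ℕ := {n | ∃ s : Finset E, (∀ q ∈ s, ‖q‖ = 1) ∧
    (∀ c ∈ s, ∀ d ∈ s, c ≠ d → ε ≤ ‖c - d‖) ∧ s.card = n}
  have hne : Sep.Nonempty := ⟨0, ∅, by simp⟩
  have hb : BddAbove Sep := by
    refine ⟨⌊(1 + 2 / ε) ^ Module.finrank ℝ E⌋₊, ?_⟩
    rintro n ⟨s, h1, h2, rfl⟩
    exact Nat.le_floor (card_le_of_separated_unitBall hε s (fun c hc => (h1 c hc).le) h2)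
  -- A separated subset of the sphere of largest cardinality is a net: a point far from all of it
  -- could be added.
  obtain ⟨s, h1, h2, h3⟩ := Nat.sSup_mem hne hb
  refine ⟨s, h1, fun v hv => ?_,
    card_le_of_separated_unitBall hε s (fun c hc => (h1 c hc).le) h2⟩
  by_contra! hcon
  have hv' : v ∉ s := fun h => by
    have := hcon v h
    rw [sub_self, norm_zero] at this
    linarith
  have hmem : s.card + 1 ∈ Sep := by
    refine ⟨insert v s, ?_, ?_, Finset.card_insert_of_notMem hv'⟩
    · intro q hq
      rcases Finset.mem_insert.1 hq with rfl | hq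
      exacts [hv, h1 q hq]
    · intro c hc d hd hcd
      rcases Finset.mem_insert.1 hc with hc' | hc' <;>
        rcases Finset.mem_insert.1 hd with hd' | hd'
      · exact absurd (hc'.trans hd'.symm) hcd
      · rw [hc']; exact (hcon d hd').le
      · rw [hd', norm_sub_rev]; exact (hcon c hc').le
      · exact h2 c hc' d hd' hcd
  have := le_csSup hb hmem
  omega

theorem Submodule.exists_net_unitSphere {E : Type*} [NormedAddCommGroup E] [NormedSpace ℂ E]
    (V : Submodule ℂ E) [FiniteDimensional ℂ V] {ε : ℝ} (hε : 0 < ε) :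
    ∃ s : Finset E, (∀ q ∈ s, ‖q‖ = 1) ∧
      (∀ v : V, ‖v‖ = 1 → ∃ q ∈ {q : V | (q : E) ∈ s}, ‖v - q‖ ≤ ε) ∧
      (s.card : ℝ) ≤ (1 + 2 / ε) ^ (2 * Module.finrank ℂ V) := by
  classical
  have : FiniteDimensional ℝ V := FiniteDimensional.complexToReal V
  obtain ⟨s, h1, h2, h3⟩ := _root_.exists_net_unitSphere V hε
  refine ⟨s.image (fun q : V => (q : E)), ?_, fun v hv => ?_, ?_⟩
  · intro q hq
    obtain ⟨q', hq', rfl⟩ := Finset.mem_image.1 hq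
    exact h1 q' hq'
  · obtain ⟨q, hq, hvq⟩ := h2 v hv
    exact ⟨q, Finset.mem_image_of_mem _ hq, hvq⟩
  · rw [← finrank_real_of_complex]
    exact (Nat.cast_le.2 Finset.card_image_le).trans h3

/-- A linear map that is almost isometric on a net is almost isometric. -/
theorem almost_isometry_of_net {V F : Type*} [NormedAddCommGroup V] [NormedSpace ℂ V]
    [NormedAddCommGroup F] [NormedSpace ℂ F] (L : V →L[ℂ] F) {δ : ℝ} (hδ0 : 0 < δ)
    (hδ : δ < 0.2) (s : Set V) (hs : ∀ v, ‖v‖ = 1 → ∃ q ∈ s, ‖v - q‖ ≤ δ / 14)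
    (hL : ∀ q ∈ s, |‖L q‖ ^ 2 - 1| ≤ δ / √2) (v : V) :
    (1 - δ) * ‖v‖ ^ 2 ≤ ‖L v‖ ^ 2 ∧ ‖L v‖ ^ 2 ≤ (1 + δ) * ‖v‖ ^ 2 := by
  have hsq : δ / √2 ≤ 0.7072 * δ := by
    rw [div_le_iff₀ (by positivity)]
    have : (1.4141 : ℝ) ≤ √2 := Real.le_sqrt_of_sq_le (by norm_num)
    nlinarith
  have hup : ∀ q ∈ s, ‖L q‖ ^ 2 ≤ 1 + 0.7072 * δ := fun q hq => by
    linarith [(abs_le.1 (hL q hq)).2]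
  have hlo : ∀ q ∈ s, 1 - 0.7072 * δ ≤ ‖L q‖ ^ 2 := fun q hq => by
    linarith [(abs_le.1 (hL q hq)).1]
  set Λ := ‖L‖
  have hΛ0 : 0 ≤ Λ := norm_nonneg _
  have unit_le : ∀ C : ℝ, (∀ v, ‖v‖ = 1 → ‖L v‖ ≤ C) → ∀ v, ‖L v‖ ≤ C * ‖v‖ := by
    intro C hC v
    rcases eq_or_ne v 0 with rfl | hv
    · simp
    have hv' : ‖v‖ ≠ 0 := norm_ne_zero_iff.2 hv
    have h1 := hC ((‖v‖⁻¹ : ℂ) • v) (by simp [norm_smul, hv'])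
    rw [map_smul, norm_smul, norm_inv, Complex.norm_real, norm_norm] at h1
    rwa [inv_mul_le_iff₀ (norm_pos_iff.2 hv), mul_comm] at h1
  have hdist : ∀ v q, ‖v - q‖ ≤ δ / 14 → ‖L v - L q‖ ≤ Λ * (δ / 14) := by
    intro v q hvq
    rw [← map_sub]
    exact (L.le_opNorm _).trans (by gcongr)
  -- Self-bounding of the operator norm: a unit vector differs from a net point by at most `δ/14`,
  -- and the image of that difference is again controlled by `Λ`.
  have hΛ : Λ ≤ √(1 + 0.7072 * δ) + Λ * (δ / 14) := by
    refine L.opNorm_le_bound (by positivity) (unit_le _ fun v hv => ?_)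
    obtain ⟨q, hq, hvq⟩ := hs v hv
    have h1 := hdist v q hvq
    have h2 : ‖L q‖ ≤ √(1 + 0.7072 * δ) := Real.le_sqrt_of_sq_le (hup q hq)
    have h3 := norm_le_norm_add_norm_sub' (L v) (L q)
    linarith
  have hΛsq : Λ ^ 2 ≤ 1 + δ := by
    have h1 : Λ * (1 - δ / 14) ≤ √(1 + 0.7072 * δ) := by linarith
    have h2 := pow_le_pow_left₀ (mul_nonneg hΛ0 (by linarith)) h1 2
    rw [Real.sq_sqrt (by positivity)] at h2
    by_contra! hcon
    have h3 : (1 + δ) * (1 - δ / 14) ^ 2 ≤ Λ ^ 2 * (1 - δ / 14) ^ 2 := by gcongr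
    have h4 : 1 + 0.7072 * δ < (1 + δ) * (1 - δ / 14) ^ 2 := by
      nlinarith [mul_pos hδ0 (sub_pos.2 hδ), pow_pos hδ0 3]
    rw [mul_pow] at h2
    linarith
  have hΛ1 : Λ ≤ 1.1 := by
    refine le_of_sq_le_sq ?_ (by norm_num)
    linarith
  constructor
  · rcases eq_or_ne v 0 with rfl | hv
    · simp
    have hv' : 0 < ‖v‖ := norm_pos_iff.2 hv
    have h1 : ∀ w, ‖w‖ = 1 → 1 - δ ≤ ‖L w‖ ^ 2 := by
      intro w hw
      obtain ⟨q, hq, hwq⟩ := hs w hw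
      have h1 := hdist w q hwq
      have h2 := hlo q hq
      have h3 := norm_le_norm_add_norm_sub (L w) (L q)
      have h4 : ‖L q‖ ≤ 1.1 := by
        refine le_of_sq_le_sq ?_ (by norm_num)
        linarith [hup q hq]
      -- `1.1/14 < 0.0786`. If `‖L w‖² < 1 - δ`, then `‖L q‖²` is at most about `1 - 0.843 δ`, below
      -- the lower bound `1 - 0.7072 δ` on the net.
      have h5 : Λ * (δ / 14) ≤ 0.0786 * δ := by nlinarith
      have h6 : ‖L q‖ ≤ ‖L w‖ + 0.0786 * δ := by linarith
      have h7 := norm_nonneg (L w)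
      have h8 := pow_le_pow_left₀ (norm_nonneg (L q)) h6 2
      by_contra! hcon
      have h9 : ‖L w‖ ≤ 1 := le_of_sq_le_sq (by linarith) zero_le_one
      nlinarith
    have h2 := h1 ((‖v‖⁻¹ : ℂ) • v) (by simp [norm_smul, hv'.ne'])
    rw [map_smul, norm_smul, norm_inv, Complex.norm_real, norm_norm, mul_pow, inv_pow,
      inv_mul_eq_div, le_div_iff₀ (by positivity)] at h2
    exact h2
  · calc ‖L v‖ ^ 2 ≤ (Λ * ‖v‖) ^ 2 := by gcongr; exact L.le_opNorm v
      _ = Λ ^ 2 * ‖v‖ ^ 2 := mul_pow _ _ _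
      _ ≤ _ := by gcongr

/-- The standard bound `(eJ/2K)^(2K)` follows from `n^n/n! ≤ e^n`; the base is at least 1 as `K ≤
J`, so the exponent may be raised to `4K`. If `J ≤ 2K`, there is only one choice. -/
theorem choose_min_le_pow {J K : ℕ} (hK : 1 ≤ K) (hKJ : K ≤ J) :
    (J.choose (min (2 * K) J) : ℝ) ≤ (Real.exp 1 * J / (2 * K)) ^ (4 * K) := by
  have hK' : (0 : ℝ) < K := by exact_mod_cast hK
  have hJ : (K : ℝ) ≤ J := by exact_mod_cast hKJ
  have he : 2 < Real.exp 1 := by linarith [Real.exp_one_gt_d9]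
  have hbase : 1 ≤ Real.exp 1 * J / (2 * K) := by
    rw [le_div_iff₀ (by positivity)]
    nlinarith
  rcases le_total (2 * K) J with h | h
  · rw [min_eq_left h]
    have h1 : (J.choose (2 * K) : ℝ) ≤ (Real.exp 1 * J / (2 * K)) ^ (2 * K) := by
      have h2 : (J.choose (2 * K) : ℝ) ≤ (J : ℝ) ^ (2 * K) / (2 * K).factorial :=
        Nat.choose_le_pow_div _ _
      have h3 := Real.pow_div_factorial_le_exp ((2 * K : ℕ) : ℝ) (by positivity) (2 * K)
      have h4 : Real.exp ((2 * K : ℕ) : ℝ) = Real.exp 1 ^ (2 * K) := by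
        rw [← Real.exp_nat_mul, mul_one]
      rw [h4] at h3
      refine h2.trans ?_
      rw [div_pow, mul_pow, le_div_iff₀ (by positivity)]
      push_cast at h3
      calc (J : ℝ) ^ (2 * K) / (2 * K).factorial * (2 * K) ^ (2 * K)
          = (J : ℝ) ^ (2 * K) * ((2 * K) ^ (2 * K) / (2 * K).factorial) := by ring
        _ ≤ (J : ℝ) ^ (2 * K) * Real.exp 1 ^ (2 * K) := by gcongr
        _ = _ := mul_comm _ _
    exact h1.trans (pow_le_pow_right₀ hbase (by omega))
  · rw [min_eq_right h, Nat.choose_self, Nat.cast_one]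
    exact one_le_pow₀ hbase

section

variable {M N J k : ℕ} {Ψ : Matrix (Fin N) (Fin J × Fin k) ℂ}

theorem finrank_blockRange_le (S : Finset (Fin J)) :
    Module.finrank ℂ (blockRange Ψ S) ≤ S.card * k := by
  classical
  have : {v | ∃ i ∈ S, ∃ l, v = WithLp.toLp 2 (fun n => Ψ n (i, l))} =
      ((S ×ˢ (Finset.univ : Finset (Fin k))).image
        fun p => WithLp.toLp 2 (fun n => Ψ n p) : Finset (EuclideanSpace ℂ (Fin N))) := by
    ext v
    simp only [Set.mem_ofPred_eq, Finset.coe_image, Set.mem_image, Finset.mem_coe,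
      Finset.mem_product, Finset.mem_univ, and_true, Prod.exists]
    constructor
    · rintro ⟨i, hi, l, rfl⟩; exact ⟨i, l, hi, rfl⟩
    · rintro ⟨i, l, hi, rfl⟩; exact ⟨i, hi, l, rfl⟩
  rw [blockRange, this]
  refine (finrank_span_finset_le_card _).trans (Finset.card_image_le.trans ?_)
  rw [Finset.card_product, Finset.card_univ, Fintype.card_fin]

theorem measurable_norm_applyMatrix_sq {α : Type*} [MeasurableSpace α]
    {A : α → Matrix (Fin M) (Fin N) ℝ} (hA : ∀ m n, Measurable fun a => A a m n)
    {v : α → EuclideanSpace ℂ (Fin N)} (hv : Measurable v) :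
    Measurable fun a => ‖applyMatrix (A a) (v a)‖ ^ 2 := by
  simp_rw [norm_applyMatrix_sq]
  have h : ∀ n, Measurable fun a => v a n := fun n =>
    (EuclideanSpace.proj (𝕜 := ℂ) n).continuous.measurable.comp hv
  have hre : ∀ n, Measurable fun a => (v a n).re := fun n => Complex.measurable_re.comp (h n)
  have him : ∀ n, Measurable fun a => (v a n).im := fun n => Complex.measurable_im.comp (h n)
  fun_prop

theorem measurableSet_norm_sq_dev (x : EuclideanSpace ℂ (Fin N)) (r : ℝ) :
    MeasurableSet {a : Fin M × Fin N → ℝ |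
      r ≤ |‖applyMatrix (Matrix.of fun m n => a (m, n)) x‖ ^ 2 - ‖x‖ ^ 2|} := by
  have h := measurable_norm_applyMatrix_sq (v := fun _ => x)
    (A := fun a : Fin M × Fin N → ℝ => Matrix.of fun m n => a (m, n))
    (fun m n => measurable_pi_apply (m, n)) measurable_const
  exact measurableSet_le measurable_const (by fun_prop)

/-- Matrices with a concentration property satisfy the restricted isometry property on unions of
blocks with high probability. -/
theorem IsConcentrationConstant.exists_measurableSet_blockRIP {K : ℕ} {ν : Measure ℝ}
    [IsProbabilityMeasure ν] {c₁ : ℝ → ℝ} (hc : IsConcentrationConstant M N ν c₁) (hK : 1 ≤ K)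
    (hKJ : K ≤ J) {δ β : ℝ} (hδ0 : 0 < δ) (hδ : δ < 0.2) (hβ : 0 < β)
    (hM : (4 * K * (k * Real.log (42 / δ) + Real.log (Real.exp 1 * J / (2 * K)))
          + Real.log (4 / β)) / c₁ (δ / √2) ≤ M)
    (Ψ : Matrix (Fin N) (Fin J × Fin k) ℂ) :
    ∃ G : Set (Fin M × Fin N → ℝ), MeasurableSet G ∧
      (Measure.pi fun _ => ν) Gᶜ ≤ ENNReal.ofReal β ∧
      ∀ a ∈ G, BlockRIP (Matrix.of fun m n => a (m, n)) Ψ (2 * K) δ := by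
  classical
  choose net hnet1 hnet2 hnet3 using fun S : Finset (Fin J) =>
    (blockRange Ψ S).exists_net_unitSphere (show 0 < δ / 14 by positivity)
  -- Only supports of maximal size are needed, since every smaller one is contained in one of these.
  let 𝒮 := Finset.powersetCard (min (2 * K) J) (Finset.univ : Finset (Fin J))
  obtain ⟨bad, hbad_def⟩ : ∃ bad : EuclideanSpace ℂ (Fin N) → Set (Fin M × Fin N → ℝ), ∀ x, bad x =
      {a | δ / √2 * ‖x‖ ^ 2 ≤ |‖applyMatrix (Matrix.of fun m n => a (m, n)) x‖ ^ 2 - ‖x‖ ^ 2|} :=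
    ⟨_, fun _ => rfl⟩
  have hbad : ∀ x, MeasurableSet (bad x) := fun x => by
    rw [hbad_def]
    exact measurableSet_norm_sq_dev x _
  refine ⟨(⋃ S ∈ 𝒮, ⋃ q ∈ net S, bad q)ᶜ, ?_, ?_, ?_⟩
  · refine MeasurableSet.compl (Finset.measurableSet_biUnion _ fun S _ => ?_)
    exact Finset.measurableSet_biUnion _ fun q _ => hbad q
  · rw [compl_compl]
    obtain ⟨hc0, hcle⟩ := hc (δ / √2) (by positivity)
    simp only [← hbad_def] at hcle
    set p := Real.exp (-c₁ (δ / √2) * M) with hp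
    have h1 : ∀ S ∈ 𝒮, (Measure.pi fun _ => ν) (⋃ q ∈ net S, bad q) ≤
        ENNReal.ofReal ((42 / δ) ^ (4 * K * k) * (4 * p)) := by
      intro S hS
      refine (measure_biUnion_finset_le _ _).trans ((Finset.sum_le_sum fun q hq =>
        hcle q ?_).trans ?_)
      · intro h0
        have := hnet1 S q hq
        rw [h0, norm_zero] at this
        exact zero_ne_one this
      · rw [Finset.sum_const, nsmul_eq_mul, ← ENNReal.ofReal_natCast,
          ← ENNReal.ofReal_mul (by positivity)]
        apply ENNReal.ofReal_le_ofReal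
        gcongr
        refine (hnet3 S).trans ?_
        have hcard : S.card ≤ 2 * K :=
          (Finset.mem_powersetCard.1 hS).2.trans_le (min_le_left _ _)
        have hdim : 2 * Module.finrank ℂ (blockRange Ψ S) ≤ 4 * K * k := by
          have := finrank_blockRange_le (Ψ := Ψ) S
          nlinarith
        have hb1 : 1 + 2 / (δ / 14) ≤ 42 / δ := by
          rw [div_div_eq_mul_div, le_div_iff₀ hδ0]
          field_simp
          linarith
        calc (1 + 2 / (δ / 14)) ^ (2 * Module.finrank ℂ (blockRange Ψ S))
            ≤ (42 / δ) ^ (2 * Module.finrank ℂ (blockRange Ψ S)) := by gcongr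
          _ ≤ (42 / δ) ^ (4 * K * k) := by
            refine pow_le_pow_right₀ ?_ hdim
            rw [le_div_iff₀ hδ0]
            linarith
    refine (measure_biUnion_finset_le _ _).trans ((Finset.sum_le_sum h1).trans ?_)
    rw [Finset.sum_const, nsmul_eq_mul, ← ENNReal.ofReal_natCast,
      ← ENNReal.ofReal_mul (by positivity)]
    apply ENNReal.ofReal_le_ofReal
    rw [Finset.card_powersetCard, Finset.card_univ, Fintype.card_fin]
    have hK0 : (0 : ℝ) < K := by exact_mod_cast hK
    have hJ0 : (0 : ℝ) < J := by exact_mod_cast (hK.trans hKJ)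
    -- The hypothesis on `M` is the logarithm of the union bound: number of supports, times net size
    -- `(42/δ)^(4Kk)` (real dimension at most `4Kk`), times `4/β`.
    have hlog : Real.log ((Real.exp 1 * J / (2 * K)) ^ (4 * K) *
        ((42 / δ) ^ (4 * K * k) * (4 / β))) ≤ c₁ (δ / √2) * M := by
      rw [Real.log_mul (by positivity) (by positivity), Real.log_mul (by positivity)
        (by positivity), Real.log_pow, Real.log_pow]
      rw [div_le_iff₀ hc0] at hM
      push_cast
      linarith
    rw [Real.log_le_iff_le_exp (by positivity)] at hlog
    have hp' : Real.exp (c₁ (δ / √2) * M) = p⁻¹ := by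
      rw [hp, ← Real.exp_neg]
      congr 1
      ring
    have hp0 : 0 < p := Real.exp_pos _
    rw [hp', ← one_div, le_div_iff₀ hp0] at hlog
    calc (J.choose (min (2 * K) J) : ℝ) * ((42 / δ) ^ (4 * K * k) * (4 * p))
        ≤ (Real.exp 1 * J / (2 * K)) ^ (4 * K) * ((42 / δ) ^ (4 * K * k) * (4 * p)) := by
          gcongr
          exact choose_min_le_pow hK hKJ
      _ = ((Real.exp 1 * J / (2 * K)) ^ (4 * K) * ((42 / δ) ^ (4 * K * k) * (4 / β)) * p) * β := by
          field_simp
      _ ≤ 1 * β := by gcongr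
      _ = β := one_mul _
  · intro a ha S hS v hv
    obtain ⟨S', hSS', hS'⟩ := Finset.exists_subsuperset_card_eq (Finset.subset_univ S)
      (n := min (2 * K) J) (le_min hS (by simpa using Finset.card_le_univ S)) (by simp)
    have hv' : v ∈ blockRange Ψ S' := blockRange_mono hSS' hv
    simp only [Set.mem_compl_iff, Set.mem_iUnion, not_exists, hbad_def, Set.mem_ofPred_eq,
      not_le] at ha
    have := almost_isometry_of_net
      (((applyMatrixLin (Matrix.of fun m n => a (m, n))).domRestrict
        (blockRange Ψ S')).toContinuousLinearMap) hδ0 hδ _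
        (hnet2 S') (fun q hq => by
          have h2 := ha S' (Finset.mem_powersetCard.2 ⟨Finset.subset_univ _, hS'.2⟩) q hq
          have h3 := hnet1 S' q hq
          rw [h3, one_pow, mul_one] at h2
          exact h2.le) ⟨v, hv'⟩
    exact this

end

/-! ### Spectral energy of the discrete prolate spheroidal sequences -/

theorem conj_exp_ofReal_mul_I (r : ℝ) :
    conj (Complex.exp (r * Complex.I)) = Complex.exp (-r * Complex.I) := by
  rw [← Complex.exp_conj]
  simp

/-- The discrete-time Fourier transform of the restriction of a sequence to `0, …, N-1`. -/
def truncatedDTFT (N : ℕ) (x : ℤ → ℝ) (f : ℝ) : ℂ :=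
  ∑ n : Fin N, (x (n : ℕ) : ℂ) * Complex.exp (-(2 * Real.pi * f * (n : ℕ) : ℝ) * Complex.I)

theorem continuous_truncatedDTFT (N : ℕ) (x : ℤ → ℝ) : Continuous (truncatedDTFT N x) := by
  unfold truncatedDTFT
  fun_prop

theorem dtft_timeLimit (N : ℕ) (x : ℤ → ℝ) (f : ℝ) :
    dtft (fun m => (timeLimit N x m : ℂ)) f = truncatedDTFT N x f := by
  have hinj : Function.Injective fun n : Fin N => ((n : ℕ) : ℤ) := fun a b h => by
    simpa [Fin.ext_iff] using h
  unfold dtft truncatedDTFT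
  rw [← hinj.tsum_eq, tsum_fintype]
  · refine Finset.sum_congr rfl fun n _ => ?_
    have : timeLimit N x ((n : ℕ) : ℤ) = x (n : ℕ) := by
      rw [timeLimit, if_pos]
      exact ⟨by positivity, by exact_mod_cast n.2⟩
    beta_reduce
    rw [this, Int.cast_natCast]
  · intro m hm
    by_contra hcon
    apply hm
    have : ¬ (0 ≤ m ∧ m < N) := by
      rintro ⟨h0, h1⟩
      lift m to ℕ using h0
      exact hcon ⟨⟨m, by exact_mod_cast h1⟩, rfl⟩
    simp [timeLimit, this]

section

variable {N : ℕ} {W : ℝ} {s : Fin N → ℤ → ℝ} {lam : Fin N → ℝ}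

/-- Pair the eigenvalue equation with the unit vector `s l` on `0, …, N-1` and move the finite sum
inside the frequency integral: it becomes the conjugate of the transform. -/
theorem IsDPSS.integral_norm_truncatedDTFT_sq (h : IsDPSS N W s lam) (l : Fin N) :
    ∫ f in (-W)..W, ‖truncatedDTFT N (s l) f‖ ^ 2 = lam l := by
  have hc := continuous_truncatedDTFT N (s l)
  have h1 : (lam l : ℂ) = ∑ n : Fin N, (s l (n : ℕ) : ℂ) * ((lam l * s l (n : ℕ) : ℝ) : ℂ) := by
    rw [show (lam l : ℂ) = ((lam l * ∑ n : Fin N, s l (n : ℕ) ^ 2 : ℝ) : ℂ) by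
      rw [h.norm_one, mul_one], Finset.mul_sum]
    push_cast
    refine Finset.sum_congr rfl fun n _ => by ring
  simp_rw [← h.eigen, bandLimit, dtft_timeLimit] at h1
  simp_rw [← intervalIntegral.integral_const_mul] at h1
  rw [← intervalIntegral.integral_finsetSum
    (fun n _ => (by fun_prop : Continuous _).intervalIntegrable _ _)] at h1
  have h2 : ∀ f : ℝ, ∑ n : Fin N, (s l (n : ℕ) : ℂ) * (truncatedDTFT N (s l) f *
      Complex.exp ((2 * Real.pi * f * ((n : ℕ) : ℤ) : ℝ) * Complex.I)) =
      ((‖truncatedDTFT N (s l) f‖ ^ 2 : ℝ) : ℂ) := by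
    intro f
    rw [← Complex.normSq_eq_norm_sq, Complex.normSq_eq_conj_mul_self]
    have hconj : conj (truncatedDTFT N (s l) f) = ∑ n : Fin N, (s l (n : ℕ) : ℂ) *
        Complex.exp ((2 * Real.pi * f * (n : ℕ) : ℝ) * Complex.I) := by
      rw [truncatedDTFT, map_sum]
      refine Finset.sum_congr rfl fun n _ => ?_
      rw [map_mul, Complex.conj_ofReal, ← Complex.ofReal_neg, conj_exp_ofReal_mul_I,
        Complex.ofReal_neg, neg_neg]
    rw [hconj, Finset.sum_mul]
    refine Finset.sum_congr rfl fun n _ => ?_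
    rw [Int.cast_natCast]
    ring
  simp_rw [h2] at h1
  rw [intervalIntegral.integral_ofReal] at h1
  exact_mod_cast h1.symm

/-- The `l`-th DPSS vector modulated to the centre frequency `f`. -/
def modulatedDPSS (s : Fin N → ℤ → ℝ) (f : ℝ) (l : Fin N) : EuclideanSpace ℂ (Fin N) :=
  WithLp.toLp 2 fun n : Fin N =>
    Complex.exp ((2 * Real.pi * f * (n : ℕ) : ℝ) * Complex.I) * (s l (n : ℕ) : ℂ)

theorem IsDPSS.orthonormal_modulatedDPSS (h : IsDPSS N W s lam) (f : ℝ) :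
    Orthonormal ℂ (modulatedDPSS s f) := by
  have key : ∀ l l', inner ℂ (modulatedDPSS s f l) (modulatedDPSS s f l') =
      ((∑ n : Fin N, s l (n : ℕ) * s l' (n : ℕ) : ℝ) : ℂ) := by
    intro l l'
    simp only [modulatedDPSS, PiLp.inner_apply, RCLike.inner_apply, map_mul, Complex.conj_ofReal,
      conj_exp_ofReal_mul_I]
    push_cast
    refine Finset.sum_congr rfl fun n _ => ?_
    rw [show ∀ a b c d : ℂ, a * b * (c * d) = (a * c) * (d * b) by intros; ring, ← Complex.exp_add]
    rw [show ∀ z : ℂ, z * Complex.I + -z * Complex.I = 0 by intros; ring, Complex.exp_zero, one_mul]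
  rw [orthonormal_iff_ite]
  intro l l'
  rw [key]
  split_ifs with hl
  · subst hl
    simp_rw [← sq]
    rw [h.norm_one, Complex.ofReal_one]
  · rw [h.orthogonal l l' hl, Complex.ofReal_zero]

/-- The modulated DPSS vectors as an orthonormal basis. -/
def IsDPSS.basis (h : IsDPSS N W s lam) (f : ℝ) :
    OrthonormalBasis (Fin N) ℂ (EuclideanSpace ℂ (Fin N)) :=
  OrthonormalBasis.mk (h.orthonormal_modulatedDPSS f) (by
    rw [(h.orthonormal_modulatedDPSS f).linearIndependent.span_eq_top_of_card_eq_finrank' (by simp)])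

theorem IsDPSS.basis_apply (h : IsDPSS N W s lam) (f : ℝ) (l : Fin N) :
    h.basis f l = modulatedDPSS s f l := by
  rw [IsDPSS.basis, OrthonormalBasis.coe_mk]

theorem modulatedDPSS_mem_blockRange {k J : ℕ} (hk : k ≤ N) (Bnyq B T : ℝ) {I : Finset (Fin J)}
    {i : Fin J} (hi : i ∈ I) {l : Fin N} (hl : (l : ℕ) < k) :
    modulatedDPSS s (bandCenter Bnyq B i * T) l ∈
      blockRange (multibandDictionary (k := k) J hk Bnyq B T s) I := by
  refine Submodule.subset_span ⟨i, hi, ⟨l, hl⟩, ?_⟩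
  rw [modulatedDPSS]
  congr 1
  ext n
  simp [multibandDictionary, modulator, dpssMatrix, Matrix.diagonal_mul]

/-- The distance to the first `k` modulated DPSS vectors is the energy in the others. -/
theorem IsDPSS.norm_sub_starProjection_sq_le (h : IsDPSS N W s lam) {k : ℕ} (f : ℝ)
    (U : Submodule ℂ (EuclideanSpace ℂ (Fin N)))
    (hU : ∀ l : Fin N, (l : ℕ) < k → modulatedDPSS s f l ∈ U) (v : EuclideanSpace ℂ (Fin N)) :
    ‖v - U.starProjection v‖ ^ 2 ≤
      ∑ l ∈ Finset.univ.filter (fun l : Fin N => k ≤ (l : ℕ)),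
        ‖inner ℂ (modulatedDPSS s f l) v‖ ^ 2 := by
  set F := Finset.univ.filter (fun l : Fin N => (l : ℕ) < k)
  set w := ∑ l ∈ F, (inner ℂ (modulatedDPSS s f l) v : ℂ) • modulatedDPSS s f l
  have hw : w ∈ U := sum_mem fun l hl => U.smul_mem _ (hU l (Finset.mem_filter.1 hl).2)
  have h1 : ‖v - U.starProjection v‖ ≤ ‖v - w‖ := by
    -- Since `w ∈ U`, subtracting it does not change the component orthogonal to `U`, and
    -- projections are contractions.
    have h2 : v - U.starProjection v = Uᗮ.starProjection (v - w) := by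
      rw [Submodule.starProjection_orthogonal_val, map_sub,
        Submodule.starProjection_eq_self_iff.2 hw]
      abel
    rw [h2]
    exact Submodule.norm_starProjection_apply_le _ _
  refine (pow_le_pow_left₀ (norm_nonneg _) h1 2).trans_eq ?_
  rw [← (h.basis f).sum_sq_norm_inner_right (v - w), Finset.sum_filter]
  refine Finset.sum_congr rfl fun l _ => ?_
  rw [h.basis_apply, inner_sub_right]
  have h3 : inner ℂ (modulatedDPSS s f l) w =
      if (l : ℕ) < k then inner ℂ (modulatedDPSS s f l) v else (0 : ℂ) := by
    simp only [w, inner_sum, inner_smul_right,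
      (orthonormal_iff_ite.1 (h.orthonormal_modulatedDPSS f)), mul_ite, mul_one, mul_zero,
      Finset.sum_ite_eq, F, Finset.mem_filter, Finset.mem_univ, true_and]
  rw [h3]
  by_cases hl : (l : ℕ) < k
  · rw [if_pos hl, if_neg (by omega), sub_self, norm_zero]; ring
  · rw [if_neg hl, if_pos (by omega), sub_zero]

end

/-! ### Energy of the samples of a multiband process outside the dictionary -/

section

variable {Ω : Type*} [MeasurableSpace Ω] {P : Measure Ω}

theorem ofReal_norm_sum_sq {ι : Type*} [Fintype ι] (z : ι → ℂ) :
    ((‖∑ m, z m‖ ^ 2 : ℝ) : ℂ) = ∑ m, ∑ n, z m * conj (z n) := by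
  rw [← Complex.normSq_eq_norm_sq, ← Complex.mul_conj, map_sum, Finset.sum_mul_sum]

theorem IsWSSWithSpectrum.autocorrelation_intervalIntegral {X : ℝ → Ω → ℂ} {a b c : ℝ}
    (hab : a ≤ b) (h : IsWSSWithSpectrum P X ((Set.Icc a b).indicator fun _ => c)) (t u : ℝ) :
    ∫ ω, X t ω * conj (X u ω) ∂P =
      ∫ F in a..b, (c : ℂ) * Complex.exp ((2 * Real.pi * F * (t - u) : ℝ) * Complex.I) := by
  have h1 := h.autocorrelation u (t - u)
  rw [add_sub_cancel] at h1
  rw [h1, intervalIntegral.integral_of_le hab, ← integral_Icc_eq_integral_Ioc,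
    ← integral_indicator measurableSet_Icc]
  congr 1
  ext F
  by_cases hF : F ∈ Set.Icc a b <;> simp [hF]

/-- The power of a linear combination of samples, in terms of the spectrum. -/
theorem IsWSSWithSpectrum.integral_norm_sum_sq {X : ℝ → Ω → ℂ} {a b c : ℝ} (hab : a ≤ b)
    (h : IsWSSWithSpectrum P X ((Set.Icc a b).indicator fun _ => c)) {ι : Type*} [Fintype ι]
    (t : ι → ℝ) (z : ι → ℂ) :
    ∫ ω, ‖∑ m, z m * X (t m) ω‖ ^ 2 ∂P =
      ∫ F in a..b, c *
        ‖∑ m, z m * Complex.exp ((2 * Real.pi * F * t m : ℝ) * Complex.I)‖ ^ 2 := by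
  have hint : ∀ m n, Integrable (fun ω => z m * X (t m) ω * conj (z n * X (t n) ω)) P := by
    intro m n
    have h1 : MemLp (fun ω => z m * X (t m) ω) 2 P := (h.memLp_two (t m)).const_mul _
    have h2 : MemLp (fun ω => conj (z n * X (t n) ω)) 2 P :=
      ((h.memLp_two (t n)).const_mul _).star
    exact h1.integrable_mul h2
  rw [← Complex.ofReal_inj, ← integral_complex_ofReal, ← intervalIntegral.integral_ofReal]
  simp only [Complex.ofReal_mul c, ofReal_norm_sum_sq]
  rw [integral_finsetSum _ fun m _ => integrable_finsetSum _ fun n _ => hint m n]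
  simp_rw [Finset.mul_sum]
  rw [intervalIntegral.integral_finsetSum
    fun m _ => (by fun_prop : Continuous _).intervalIntegrable _ _]
  refine Finset.sum_congr rfl fun m _ => ?_
  rw [integral_finsetSum _ fun n _ => hint m n, intervalIntegral.integral_finsetSum
    fun m _ => (by fun_prop : Continuous _).intervalIntegrable _ _]
  refine Finset.sum_congr rfl fun n _ => ?_
  have e1 : ∀ ω, z m * X (t m) ω * conj (z n * X (t n) ω) =
      z m * conj (z n) * (X (t m) ω * conj (X (t n) ω)) := fun ω => by
    rw [map_mul]; ring
  simp_rw [e1]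
  rw [integral_const_mul, h.autocorrelation_intervalIntegral hab,
    ← intervalIntegral.integral_const_mul]
  congr 1
  ext F
  rw [map_mul, conj_exp_ofReal_mul_I]
  have : Complex.exp ((2 * Real.pi * F * (t m - t n) : ℝ) * Complex.I) =
      Complex.exp ((2 * Real.pi * F * t m : ℝ) * Complex.I) *
        Complex.exp (-(2 * Real.pi * F * t n : ℝ) * Complex.I) := by
    rw [← Complex.exp_add]
    congr 1
    push_cast
    ring
  rw [this]
  ring

variable {N : ℕ} {W : ℝ} {s : Fin N → ℤ → ℝ} {lam : Fin N → ℝ}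

theorem inner_modulatedDPSS (f : ℝ) (l : Fin N) (v : EuclideanSpace ℂ (Fin N)) :
    inner ℂ (modulatedDPSS s f l) v = ∑ n : Fin N, (s l (n : ℕ) : ℂ) *
      Complex.exp (-(2 * Real.pi * f * (n : ℕ) : ℝ) * Complex.I) * v n := by
  simp only [modulatedDPSS, PiLp.inner_apply, RCLike.inner_apply, map_mul, Complex.conj_ofReal,
    conj_exp_ofReal_mul_I]
  refine Finset.sum_congr rfl fun n _ => by ring

/-- The power of the `l`-th modulated DPSS coefficient of the samples of a bandpass process. -/
theorem IsDPSS.integral_norm_inner_sampleVector_sq {B T : ℝ} (hB : 0 < B) (hT : 0 < T)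
    (h : IsDPSS N (B * T / 2) s lam) {Bnyq c : ℝ} {i : ℕ} {X : ℝ → Ω → ℂ}
    (hX : IsWSSWithSpectrum P X ((band Bnyq B i).indicator fun _ => c)) (l : Fin N) :
    ∫ ω, ‖(inner ℂ (modulatedDPSS s (bandCenter Bnyq B i * T) l)
      (sampleVector N T fun t => X t ω) : ℂ)‖ ^ 2 ∂P = c / T * lam l := by
  simp_rw [inner_modulatedDPSS]
  have hab : -Bnyq / 2 + i * B ≤ -Bnyq / 2 + (i + 1) * B := by linarith
  have h1 := IsWSSWithSpectrum.integral_norm_sum_sq hab hX (fun n : Fin N => (n : ℕ) * T)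
    (fun n : Fin N => (s l (n : ℕ) : ℂ) *
      Complex.exp (-(2 * Real.pi * (bandCenter Bnyq B i * T) * (n : ℕ) : ℝ) * Complex.I))
  refine h1.trans ?_
  rw [intervalIntegral.integral_const_mul]
  have h2 : ∀ F : ℝ, ∑ n : Fin N, (s l (n : ℕ) : ℂ) *
      Complex.exp (-(2 * Real.pi * (bandCenter Bnyq B i * T) * (n : ℕ) : ℝ) * Complex.I) *
      Complex.exp ((2 * Real.pi * F * ((n : ℕ) * T) : ℝ) * Complex.I) =
      truncatedDTFT N (s l) (bandCenter Bnyq B i * T - T * F) := by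
    intro F
    unfold truncatedDTFT
    refine Finset.sum_congr rfl fun n _ => ?_
    rw [mul_assoc, ← Complex.exp_add]
    congr 2
    push_cast
    ring
  simp_rw [h2]
  -- The substitution `f = F_i T - T F` carries the band onto `[-BT/2, BT/2]` and contributes the
  -- Jacobian `1/T`.
  rw [intervalIntegral.integral_comp_sub_mul
    (fun f => ‖truncatedDTFT N (s l) f‖ ^ 2) hT.ne']
  rw [show bandCenter Bnyq B i * T - T * (-Bnyq / 2 + (i + 1) * B) = -(B * T / 2) by
      unfold bandCenter; ring,
    show bandCenter Bnyq B i * T - T * (-Bnyq / 2 + i * B) = B * T / 2 by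
      unfold bandCenter; ring, h.integral_norm_truncatedDTFT_sq, smul_eq_mul]
  ring

theorem norm_sum_sq_le_card_mul {ι E : Type*} [SeminormedAddCommGroup E] (s : Finset ι)
    (v : ι → E) : ‖∑ i ∈ s, v i‖ ^ 2 ≤ s.card * ∑ i ∈ s, ‖v i‖ ^ 2 :=
  (pow_le_pow_left₀ (norm_nonneg _) (norm_sum_le _ _) 2).trans sq_sum_le_card_mul_sum_sq

theorem IsMultibandProcess.measurable {J : ℕ} {Bnyq B : ℝ} {I : Finset (Fin J)} {x : ℝ → Ω → ℂ}
    (h : IsMultibandProcess P Bnyq B I x) (t : ℝ) : Measurable (x t) := by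
  obtain ⟨X, hX, _, hx⟩ := h
  rw [show x t = fun ω => ∑ i : I, X i t ω from funext (hx t)]
  exact Finset.measurable_fun_sum _ fun i _ => (hX i).measurable t

theorem IsMultibandProcess.integral_eq_zero {J : ℕ} {Bnyq B : ℝ} {I : Finset (Fin J)}
    {x : ℝ → Ω → ℂ} [IsProbabilityMeasure P] (h : IsMultibandProcess P Bnyq B I x) (t : ℝ) :
    ∫ ω, x t ω ∂P = 0 := by
  obtain ⟨X, hX, _, hx⟩ := h
  simp_rw [hx]
  rw [integral_finsetSum _ fun i _ => ((hX i).memLp_two t).integrable (by norm_num)]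
  exact Finset.sum_eq_zero fun i _ => (hX i).mean_zero t

/-- The expected energy of the samples of a multiband process outside the range of the active
blocks of the dictionary. -/
theorem IsMultibandProcess.integral_norm_sub_starProjection_sq_le [IsProbabilityMeasure P]
    {J k K : ℕ} (hk : k ≤ N) {B Bnyq T : ℝ} (hB : 0 < B) (hT : 0 < T) (hW : W = B * T / 2)
    (h : IsDPSS N W s lam) {I : Finset (Fin J)} (hI : I.card = K) (hK : 1 ≤ K) {x : ℝ → Ω → ℂ}
    (hx : IsMultibandProcess P Bnyq B I x) :
    ∫ ω, ‖sampleVector N T (fun t => x t ω) -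
        (blockRange (multibandDictionary (k := k) J hk Bnyq B T s) I).starProjection
          (sampleVector N T (fun t => x t ω))‖ ^ 2 ∂P ≤
      K / (2 * W) * ∑ l ∈ Finset.univ.filter (fun l : Fin N => k ≤ (l : ℕ)), lam l := by
  subst hW
  obtain ⟨X, hX, _, hxX⟩ := hx
  set U := blockRange (multibandDictionary (k := k) J hk Bnyq B T s) I
  set H := Finset.univ.filter (fun l : Fin N => k ≤ (l : ℕ))
  have hsum : ∀ ω, sampleVector N T (fun t => x t ω) =
      ∑ i : I, sampleVector N T (fun t => X i t ω) := by
    intro ω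
    ext n
    simp [sampleVector, hxX]
  let g : I → Fin N → Ω → ℝ := fun i l ω =>
    ‖(inner ℂ (modulatedDPSS s (bandCenter Bnyq B (i : Fin J) * T) l)
      (sampleVector N T fun t => X i t ω) : ℂ)‖ ^ 2
  have hgint : ∀ i l, Integrable (g i l) P := by
    intro i l
    have : MemLp (fun ω => (inner ℂ (modulatedDPSS s (bandCenter Bnyq B (i : Fin J) * T) l)
        (sampleVector N T fun t => X i t ω) : ℂ)) 2 P := by
      simp_rw [inner_modulatedDPSS]
      exact memLp_finsetSum _ fun n _ => ((hX i).memLp_two _).const_mul _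
    exact this.integrable_norm_pow (by norm_num)
  -- Each band component is approximated from its own block alone; Cauchy–Schwarz over the `K` bands
  -- costs a factor `K`.
  have hle : ∀ ω, ‖sampleVector N T (fun t => x t ω) -
      U.starProjection (sampleVector N T (fun t => x t ω))‖ ^ 2 ≤
      K * ∑ i : I, ∑ l ∈ H, g i l ω := by
    intro ω
    rw [hsum, map_sum, ← Finset.sum_sub_distrib]
    refine (norm_sum_sq_le_card_mul _ _).trans ?_
    rw [Finset.card_univ, Fintype.card_coe, hI]
    gcongr with i
    exact h.norm_sub_starProjection_sq_le _ U
      (fun l hl => modulatedDPSS_mem_blockRange hk Bnyq B T i.2 hl) _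
  have hint : Integrable (fun ω => (K : ℝ) * ∑ i : I, ∑ l ∈ H, g i l ω) P :=
    (integrable_finsetSum _ fun i _ => integrable_finsetSum _ fun l _ => hgint i l).const_mul _
  refine (integral_mono_of_nonneg (ae_of_all _ fun ω => sq_nonneg _) hint
    (ae_of_all _ hle)).trans_eq ?_
  rw [integral_const_mul, integral_finsetSum _ fun i _ =>
    integrable_finsetSum _ fun l _ => hgint i l]
  have hK' : (K : ℝ) ≠ 0 := by exact_mod_cast (by omega : K ≠ 0)
  -- The Cauchy–Schwarz factor `K`, the `K` summands and the density `1/(KB)` combine to `K/(BT) =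
  -- K/(2W)`.
  have hi : ∀ i : I, ∫ ω, ∑ l ∈ H, g i l ω ∂P = 1 / (K * B) / T * ∑ l ∈ H, lam l := by
    intro i
    rw [integral_finsetSum _ fun l _ => hgint i l, Finset.mul_sum]
    refine Finset.sum_congr rfl fun l _ => ?_
    rw [← hI]
    exact h.integral_norm_inner_sampleVector_sq hB hT (hX i) l
  simp_rw [hi]
  rw [Finset.sum_const, Finset.card_univ, Fintype.card_coe, hI, nsmul_eq_mul]
  field_simp

end

/-! ### Tail bound for the energy of a centred Gaussian vector -/

section

variable {Ω : Type*} [MeasurableSpace Ω] {P : Measure Ω}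

/-- For a centred Gaussian the subgaussian bound is an equality with the variance as parameter, as
`measure_sum_sq_gt_le` requires. -/
theorem HasGaussianLaw.hasSubgaussianMGF_of_integral_eq_zero {X : Ω → ℝ}
    (h : HasGaussianLaw X P) (h0 : ∫ ω, X ω ∂P = 0) :
    HasSubgaussianMGF X (Var[X; P]).toNNReal P := by
  have hmap := h.map_eq_gaussianReal
  rw [h0] at hmap
  rw [← HasSubgaussianMGF.id_map_iff h.aemeasurable, hmap]
  refine ⟨fun t => integrable_exp_mul_gaussianReal t, fun t => ?_⟩
  rw [mgf_id_gaussianReal]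
  simp

theorem IsGaussianProcess.hasGaussianLaw_sampleVector {x : ℝ → Ω → ℂ}
    (h : IsGaussianProcess x P) (N : ℕ) (T : ℝ) :
    HasGaussianLaw (fun ω => sampleVector N T fun t => x t ω) P := by
  have h1 := (h.comp_right fun n : Fin N => (n : ℕ) * T).hasGaussianLaw Finset.univ
  let L : (↥(Finset.univ : Finset (Fin N)) → ℂ) →ₗ[ℝ] EuclideanSpace ℂ (Fin N) :=
    { toFun := fun v => WithLp.toLp 2 fun n => v ⟨n, Finset.mem_univ n⟩
      map_add' := fun _ _ => rfl
      map_smul' := fun _ _ => rfl }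
  exact h1.map_fun (LinearMap.toContinuousLinearMap L)

/-- The energy of a linear image of a centred Gaussian vector exceeds its expectation by a factor
`1 + γ` with exponentially small probability. -/
theorem measure_norm_sq_gt_le_of_hasGaussianLaw {E : Type*} [NormedAddCommGroup E]
    [NormedSpace ℝ E] [FiniteDimensional ℝ E] [MeasurableSpace E] [BorelSpace E] {N : ℕ}
    {Y : Ω → E} (hm : Measurable Y) (h : HasGaussianLaw Y P) (h0 : ∫ ω, Y ω ∂P = 0)
    (L : E →L[ℝ] EuclideanSpace ℂ (Fin N)) {V γ : ℝ} (hV : ∫ ω, ‖L (Y ω)‖ ^ 2 ∂P ≤ V)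
    (hγ : 0 < γ) :
    P {ω | (1 + γ) * V < ‖L (Y ω)‖ ^ 2} ≤
      ENNReal.ofReal (Real.exp (-min (γ ^ 2 / 112 ^ 2) (γ / 112))) := by
  have := h.isProbabilityMeasure
  have := FiniteDimensional.complete ℝ E
  have : ProperSpace E := FiniteDimensional.proper_real E
  -- The `2N` real coordinates of `L Y` are centred Gaussians, possibly correlated, whose variances
  -- sum to the expected energy.
  let φ : Fin N ⊕ Fin N → (E →L[ℝ] ℝ) := Sum.elim
    (fun n => Complex.reCLM ∘L (((EuclideanSpace.proj n :
      EuclideanSpace ℂ (Fin N) →L[ℂ] ℂ).restrictScalars ℝ) ∘L L))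
    (fun n => Complex.imCLM ∘L (((EuclideanSpace.proj n :
      EuclideanSpace ℂ (Fin N) →L[ℂ] ℂ).restrictScalars ℝ) ∘L L))
  have hnorm : ∀ ω, ‖L (Y ω)‖ ^ 2 = ∑ j, φ j (Y ω) ^ 2 := by
    intro ω
    rw [norm_sq_eq_sum_re_add_sum_im, Fintype.sum_sum_type]
    rfl
  have hg : ∀ j, HasGaussianLaw (fun ω => φ j (Y ω)) P := fun j => h.map_fun (φ j)
  have hz : ∀ j, ∫ ω, φ j (Y ω) ∂P = 0 := fun j => by
    rw [(φ j).integral_comp_comm h.integrable, h0, map_zero]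
  have hv : ∀ j, ∫ ω, φ j (Y ω) ^ 2 ∂P = (Var[fun ω => φ j (Y ω); P]).toNNReal := fun j => by
    rw [Real.coe_toNNReal _ (variance_nonneg _ _),
      variance_of_integral_eq_zero (hg j).aemeasurable (hz j)]
  simp_rw [hnorm] at hV ⊢
  refine measure_sum_sq_gt_le (z := fun j ω => φ j (Y ω)) (fun j => (φ j).continuous.measurable.comp hm)
    (fun j => HasGaussianLaw.hasSubgaussianMGF_of_integral_eq_zero (hg j) (hz j)) hv ?_ hγ
  rw [integral_finsetSum _ fun j _ => (hg j).memLp_two.integrable_sq] at hV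
  simpa only [hv] using hV

/-- A concentration constant controls the norm of the image of an independent random vector. -/
theorem IsConcentrationConstant.measure_norm_applyMatrix_gt_le {M N : ℕ} {ν : Measure ℝ}
    [IsProbabilityMeasure ν] {c₁ : ℝ → ℝ} (hc : IsConcentrationConstant M N ν c₁)
    [IsProbabilityMeasure P] {E : Type*} [MeasurableSpace E] {A : Ω → Fin M × Fin N → ℝ}
    (hA : Measurable A) (hAν : P.map A = Measure.pi fun _ => ν) {Y : Ω → E} (hY : Measurable Y)
    (hind : IndepFun A Y P) {L : E → EuclideanSpace ℂ (Fin N)} (hL : Measurable L) {η : ℝ}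
    (hη : 0 < η) :
    P {ω | (1 + η) * ‖L (Y ω)‖ ^ 2 <
        ‖applyMatrix (Matrix.of fun m n => A ω (m, n)) (L (Y ω))‖ ^ 2} ≤
      ENNReal.ofReal (4 * Real.exp (-c₁ η * M)) := by
  have hjoint := (indepFun_iff_map_prod_eq_prod_map_map hY.aemeasurable hA.aemeasurable).1
    hind.symm
  rw [hAν] at hjoint
  let D : Set (E × (Fin M × Fin N → ℝ)) := {p | (1 + η) * ‖L p.1‖ ^ 2 <
    ‖applyMatrix (Matrix.of fun m n => p.2 (m, n)) (L p.1)‖ ^ 2}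
  have hD : MeasurableSet D := by
    refine measurableSet_lt (by fun_prop) ?_
    exact measurable_norm_applyMatrix_sq (fun m n => by simp only [Matrix.of_apply]; fun_prop)
      (hL.comp measurable_fst)
  have : {ω | (1 + η) * ‖L (Y ω)‖ ^ 2 <
      ‖applyMatrix (Matrix.of fun m n => A ω (m, n)) (L (Y ω))‖ ^ 2} =
      (fun ω => (Y ω, A ω)) ⁻¹' D := rfl
  have hprob : IsProbabilityMeasure (P.map Y) := Measure.isProbabilityMeasure_map hY.aemeasurable
  rw [this, ← Measure.map_apply (hY.prodMk hA) hD, hjoint, Measure.prod_apply hD]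
  -- Conditioning on `Y = v` fixes the vector `L v`. If it is zero the event is empty; otherwise the
  -- concentration bound applies.
  calc ∫⁻ v, (Measure.pi fun _ => ν) (Prod.mk v ⁻¹' D) ∂(P.map Y)
      ≤ ∫⁻ _, ENNReal.ofReal (4 * Real.exp (-c₁ η * M)) ∂(P.map Y) := by
        refine lintegral_mono fun v => ?_
        by_cases hv : L v = 0
        · have : Prod.mk v ⁻¹' D = ∅ := by
            ext a
            simp [D, hv, ← applyMatrixLin_apply]
          simp [this]
        · refine (measure_mono fun a ha => ?_).trans ((hc η hη).2 (L v) hv)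
          simp only [D, Set.mem_preimage, Set.mem_ofPred_eq] at ha ⊢
          exact le_trans (by linarith) (le_abs_self _)
    _ = _ := by rw [lintegral_const, measure_univ, mul_one]

end

/-! ### The recovery guarantee -/

section

variable {Ω : Type*} [MeasurableSpace Ω] {P : Measure Ω}

theorem IsMultibandProcess.integral_sampleVector_eq_zero [IsProbabilityMeasure P] {J : ℕ}
    {Bnyq B : ℝ} {I : Finset (Fin J)} {x : ℝ → Ω → ℂ} (h : IsMultibandProcess P Bnyq B I x)
    (hg : IsGaussianProcess x P) (N : ℕ) (T : ℝ) :
    ∫ ω, sampleVector N T (fun t => x t ω) ∂P = 0 := by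
  ext n
  have := (EuclideanSpace.proj n : EuclideanSpace ℂ (Fin N) →L[ℂ] ℂ).integral_comp_comm
    (IsGaussianProcess.hasGaussianLaw_sampleVector hg N T).integrable
  exact this.symm.trans (h.integral_eq_zero _)

theorem measurable_sampleVector {x : ℝ → Ω → ℂ} (hx : ∀ t, Measurable (x t)) (N : ℕ) (T : ℝ) :
    Measurable fun ω => sampleVector N T fun t => x t ω :=
  (WithLp.measurable_toLp 2 _).comp (measurable_pi_lambda _ fun _ => hx _)

theorem one_sub_le_measureReal_inter [IsProbabilityMeasure P] {E₁ E₂ E₃ : Set Ω}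
    {p₁ p₂ p₃ : ℝ} (h₁ : 0 ≤ p₁) (h₂ : 0 ≤ p₂) (h₃ : 0 ≤ p₃) (hm₁ : MeasurableSet E₁)
    (hm₂ : MeasurableSet E₂) (hm₃ : MeasurableSet E₃) (hp₁ : P E₁ᶜ ≤ ENNReal.ofReal p₁)
    (hp₂ : P E₂ᶜ ≤ ENNReal.ofReal p₂) (hp₃ : P E₃ᶜ ≤ ENNReal.ofReal p₃) :
    1 - p₁ - p₂ - p₃ ≤ P.real (E₁ ∩ E₂ ∩ E₃) := by
  have hr := probReal_compl_eq_one_sub (μ := P) ((hm₁.inter hm₂).inter hm₃)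
  have hle : P (E₁ ∩ E₂ ∩ E₃)ᶜ ≤ ENNReal.ofReal (p₁ + p₂ + p₃) := by
    rw [Set.compl_inter, Set.compl_inter, ENNReal.ofReal_add (by positivity) h₃,
      ENNReal.ofReal_add h₁ h₂]
    exact (measure_union_le _ _).trans
      (add_le_add ((measure_union_le _ _).trans (add_le_add hp₁ hp₂)) hp₃)
  have hle' : P.real (E₁ ∩ E₂ ∩ E₃)ᶜ ≤ p₁ + p₂ + p₃ :=
    ENNReal.toReal_le_of_le_ofReal (by positivity) hle
  linarith

end

/-- From the error of the iterates relative to the block-sparse part to the error bound of the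
recovery guarantee. -/
theorem sq_le_of_le_add_mul {e d b V κ q η γ : ℝ} (he : 0 ≤ e) (hd : 0 ≤ d) (hκ : 0 ≤ κ)
    (hV : d ^ 2 ≤ (1 + γ) * V) (hη : 0 ≤ η) (hbd : b ^ 2 ≤ (1 + η) * d ^ 2)
    (h : e ≤ d + (q + κ * b)) :
    e ^ 2 ≤ (q + √((1 + κ * √(1 + η)) ^ 2 * (1 + γ) * V)) ^ 2 := by
  have hb : b ≤ √(1 + η) * d := by
    refine le_of_sq_le_sq ?_ (by positivity)
    rwa [mul_pow, Real.sq_sqrt (by positivity)]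
  have h1 : (1 + κ * √(1 + η)) * d ≤ √((1 + κ * √(1 + η)) ^ 2 * (1 + γ) * V) := by
    refine Real.le_sqrt_of_sq_le ?_
    rw [mul_pow, mul_assoc]
    gcongr
  have h2 := mul_le_mul_of_nonneg_left hb hκ
  exact pow_le_pow_left₀ he (by linarith) 2

/-- The recovery guarantee on the event that `A` has the restricted isometry property and that the
energy outside the active blocks and its image under `A` are controlled. -/
theorem IsBlockIHT.norm_sub_sq_le {M N J k K : ℕ} {Ψ : Matrix (Fin N) (Fin J × Fin k) ℂ}
    {A : Matrix (Fin M) (Fin N) ℝ} {δ μ η γ τ V R : ℝ} (hδ0 : 0 < δ) (hδ : δ < 0.2)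
    (hμ1 : 1 + δ ≤ 1 / μ) (hμ2 : 1 / μ < 1.5 * (1 - δ)) (hRIP : BlockRIP A Ψ (2 * K) δ)
    {I : Finset (Fin J)} (hI : I.card ≤ K) {xs x' : EuclideanSpace ℂ (Fin N)}
    (hx' : x' ∈ blockRange Ψ I) {u : ℕ → EuclideanSpace ℂ (Fin N)}
    (hu : IsBlockIHT A Ψ K μ (applyMatrix A xs) u) (hη : 0 ≤ η) (hτ : 0 < τ)
    (hb : ‖applyMatrix A (xs - x')‖ ^ 2 ≤ (1 + η) * ‖xs - x'‖ ^ 2)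
    (hd : ‖xs - x'‖ ^ 2 ≤ (1 + γ) * V)
    (hR : R = (1 + (2 * |τ| + 8) * √(1 + η)) ^ 2 * (1 + γ) * V) :
    (∀ n : ℕ, (1 / (μ * (1 - δ)) - 1) ^ n * ‖x'‖ ^ 2 ≤
        τ ^ 2 * ‖applyMatrix A (xs - x')‖ ^ 2 → ‖xs - u n‖ ^ 2 ≤ R) ∧
      (∀ ε : ℝ, 0 < ε → ∀ᶠ n in atTop, ‖xs - u n‖ ^ 2 ≤ R + ε) := by
  have hbound := hu.norm_sub_le hδ0 hδ hμ1 hμ2 hRIP hI hx'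
  set ρ := 1 / (μ * (1 - δ)) - 1 with hρ
  set b := ‖applyMatrix A (xs - x')‖
  have hb0 : 0 ≤ b := norm_nonneg _
  have htri : ∀ n, ‖xs - u n‖ ≤ ‖xs - x'‖ + (2 * (√ρ ^ n * ‖x'‖) + 8 * b) := fun n => by
    have h1 := norm_sub_le_norm_sub_add_norm_sub xs x' (u n)
    linarith [hbound n]
  obtain ⟨hρ0, hρ1⟩ := convergenceRate_mem_Icc hδ0 hδ hμ1 hμ2
  rw [← hρ] at hρ0 hρ1
  have hV0 : 0 ≤ (1 + γ) * V := (sq_nonneg _).trans hd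
  have hR0 : 0 ≤ R := by
    rw [hR, mul_assoc]
    positivity
  constructor
  · intro n hn
    -- This is the square root of the stopping criterion; the error `2τb + 8b` is then `κ * b` with
    -- `κ = 2τ + 8`, and no transient term `q` remains.
    have h1 : √ρ ^ n * ‖x'‖ ≤ τ * b := by
      refine le_of_sq_le_sq ?_ (by positivity)
      rwa [mul_pow, mul_pow, ← pow_mul, mul_comm n, pow_mul, Real.sq_sqrt hρ0]
    have h2 := sq_le_of_le_add_mul (q := 0) (κ := 2 * |τ| + 8) (norm_nonneg (xs - u n))
      (norm_nonneg _) (by positivity) hd hη hb (by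
        rw [abs_of_pos hτ]
        linarith [htri n])
    rw [zero_add, ← hR, Real.sq_sqrt hR0] at h2
    exact h2
  · intro ε hε
    -- Here the transient is kept as `q` and tends to zero because `√ρ < 1`.
    have hlim : Tendsto (fun n => (2 * (√ρ ^ n * ‖x'‖) + √R) ^ 2) atTop (nhds R) := by
      have h1 : Tendsto (fun n => √ρ ^ n) atTop (nhds 0) :=
        tendsto_pow_atTop_nhds_zero_of_lt_one (Real.sqrt_nonneg _)
          (by rw [Real.sqrt_lt' one_pos, one_pow]; linarith)
      have h2 := (((h1.mul_const ‖x'‖).const_mul 2).add_const √R).pow 2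
      simpa [Real.sq_sqrt hR0] using h2
    filter_upwards [hlim.eventually_le_const (show R < R + ε by linarith)] with n hn
    refine le_trans ?_ hn
    rw [hR]
    refine sq_le_of_le_add_mul (κ := 2 * |τ| + 8) (norm_nonneg _) (norm_nonneg _)
      (by positivity) hd hη hb ((htri n).trans ?_)
    have : 0 ≤ |τ| * b := by positivity
    linarith

end

theorem mainTheorem1 :
    -- the universal constant `c₂` and the constant `κ₁ = κ₁(δ, τ)`, where `τ` is the tolerance
    -- in the stopping criterion
    ∃ c₂ : ℝ, 0 < c₂ ∧ ∃ κ₁ : ℝ → ℝ → ℝ, (∀ δ τ : ℝ, 1 < κ₁ δ τ) ∧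
    ∀ c₀ : ℝ, 0 < c₀ →
    -- there are concentration constants that depend only on `η` and `c₀`
    (∃ c₁ : ℝ → ℝ, ∀ (M N : ℕ) (ν : Measure ℝ), IsSubgaussianEntryLaw c₀ M ν →
      IsConcentrationConstant M N ν c₁) ∧
    -- the guarantee, for every concentration constant `c₁`
    ∀ (N k J K M : ℕ) (_ : 1 ≤ k) (hk : k ≤ N) (_ : 1 ≤ K)
      (Bnyq B T W : ℝ) (_ : 0 < B) (_ : (J : ℝ) = Bnyq / B) (_ : 0 < T) (_ : T ≤ 1 / Bnyq)
      (_ : W = B * T / 2)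
      (s : Fin N → ℤ → ℝ) (lam : Fin N → ℝ) (_ : IsDPSS N W s lam)
      (δ β η γ τ μ : ℝ) (_ : 0 < δ) (_ : δ < 0.2) (_ : 0 < β) (_ : β < 1) (_ : 0 < η)
      (_ : 0 < γ) (_ : 0 < τ) (_ : 1 + δ ≤ 1 / μ) (_ : 1 / μ < 1.5 * (1 - δ))
      (ν : Measure ℝ) (_ : IsSubgaussianEntryLaw c₀ M ν)
      (c₁ : ℝ → ℝ) (_ : IsConcentrationConstant M N ν c₁)
      (_ : (4 * K * (k * Real.log (42 / δ) + Real.log (Real.exp 1 * J / (2 * K)))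
          + Real.log (4 / β)) / c₁ (δ / √2) ≤ M)
      (Ω : Type*) [MeasurableSpace Ω] (P : Measure Ω) [IsProbabilityMeasure P]
      -- the random matrix `A`
      (A : Ω → Matrix (Fin M) (Fin N) ℝ)
      (_ : ∀ m n, Measurable fun ω => A ω m n)
      (_ : ∀ m n, P.map (fun ω => A ω m n) = ν)
      (_ : iIndepFun (fun (p : Fin M × Fin N) ω => A ω p.1 p.2) P)
      -- the Gaussian process `x(t)`, whose samples are independent of `A`
      (I : Finset (Fin J)) (_ : I.card = K) (x : ℝ → Ω → ℂ)
      (_ : IsMultibandProcess P Bnyq B I x) (_ : IsGaussianProcess x P)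
      (_ : IndepFun (fun ω (p : Fin M × Fin N) => A ω p.1 p.2)
        (fun ω (n : Fin N) => x ((n : ℕ) * T) ω) P),
    ∃ G : Set Ω, MeasurableSet G ∧
      1 - β - 4 * Real.exp (-c₁ η * M) - 2 * Real.exp (-min (γ ^ 2 / c₂ ^ 2) (γ / c₂))
        ≤ P.real G ∧
      ∀ ω ∈ G, ∀ (Ψ : Matrix (Fin N) (Fin J × Fin k) ℂ) (xs x' : EuclideanSpace ℂ (Fin N))
        (R : ℝ) (u : ℕ → EuclideanSpace ℂ (Fin N)),
        Ψ = multibandDictionary J hk Bnyq B T s →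
        -- the sample vector and its projection onto the active blocks
        xs = sampleVector N T (fun t => x t ω) →
        x' = (blockRange Ψ I).starProjection xs →
        -- the right-hand side of the error bound
        R = (1 + κ₁ δ τ * √(1 + η)) ^ 2 * (1 + γ) *
          (K / (2 * W) * ∑ l ∈ Finset.univ.filter (fun l : Fin N => k ≤ (l : ℕ)), lam l) →
        IsBlockIHT (A ω) Ψ K μ (applyMatrix (A ω) xs) u →
        -- the estimate after finitely many iterations, as soon as the stopping criterion holds
        (∀ n : ℕ, (1 / (μ * (1 - δ)) - 1) ^ n * ‖x'‖ ^ 2 ≤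
            τ ^ 2 * ‖applyMatrix (A ω) (xs - x')‖ ^ 2 → ‖xs - u n‖ ^ 2 ≤ R) ∧
        -- the estimate in the limit of infinitely many iterations
        (∀ ε : ℝ, 0 < ε → ∀ᶠ n in atTop, ‖xs - u n‖ ^ 2 ≤ R + ε) := by

  refine ⟨112, by norm_num, fun _ τ => 2 * |τ| + 8,
    fun _ τ => by linarith [abs_nonneg τ], fun c₀ hc₀ => ⟨⟨subgaussianConcentration c₀,
      fun M N ν h => isConcentrationConstant_subgaussianConcentration hc₀ h⟩, ?_⟩⟩
  intro N k J K M _ hk hK Bnyq B T W hB _ hT _ hW s lam hs δ β η γ τ μ hδ0 hδ hβ _ hη hγ hτ hμ1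
    hμ2 ν hν c₁ hc₁ hM Ω _ P _ A hAm hAν hAi I hI x hx hxg hind
  have := hν.isProbabilityMeasure
  have hKJ : K ≤ J := by
    rw [← hI]
    simpa using Finset.card_le_univ I
  set U := blockRange (multibandDictionary (k := k) J hk Bnyq B T s) I
  set V : ℝ := K / (2 * W) * ∑ l ∈ Finset.univ.filter (fun l : Fin N => k ≤ (l : ℕ)), lam l
  have hV := hx.integral_norm_sub_starProjection_sq_le hk hB hT hW hs hI hK
  obtain ⟨G₁, hG₁m, hG₁, hRIP⟩ := hc₁.exists_measurableSet_blockRIP hK hKJ hδ0 hδ hβ hM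
    (multibandDictionary (k := k) J hk Bnyq B T s)
  have hAm' : Measurable fun ω (p : Fin M × Fin N) => A ω p.1 p.2 :=
    measurable_pi_lambda _ fun p => hAm p.1 p.2
  have hAlaw : P.map (fun ω (p : Fin M × Fin N) => A ω p.1 p.2) = Measure.pi fun _ => ν := by
    have h := (iIndepFun_iff_map_fun_eq_pi_map (f := fun (p : Fin M × Fin N) ω => A ω p.1 p.2)
      fun p => (hAm p.1 p.2).aemeasurable).1 hAi
    simp only [hAν] at h
    exact h
  have hYm := measurable_sampleVector hx.measurable N T
  -- The projection onto the orthogonal complement of the active blocks, so that `L xs = xs - x'` is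
  -- a linear image of the Gaussian samples.
  let L : EuclideanSpace ℂ (Fin N) →L[ℂ] EuclideanSpace ℂ (Fin N) :=
    ContinuousLinearMap.id ℂ _ - U.starProjection
  have hG₂ := hc₁.measure_norm_applyMatrix_gt_le hAm' hAlaw
    (measurable_pi_lambda _ fun n : Fin N => hx.measurable ((n : ℕ) * T)) hind
    (L := fun v => L (WithLp.toLp 2 v))
    (L.continuous.measurable.comp (WithLp.measurable_toLp 2 _)) hη
  have hG₃ := measure_norm_sq_gt_le_of_hasGaussianLaw hYm
    (IsGaussianProcess.hasGaussianLaw_sampleVector hxg N T)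
    (hx.integral_sampleVector_eq_zero hxg N T) (L.restrictScalars ℝ) (V := V) hV hγ
  let E₂ : Set Ω := {ω | ‖applyMatrix (A ω) (L (sampleVector N T fun t => x t ω))‖ ^ 2 ≤
    (1 + η) * ‖L (sampleVector N T fun t => x t ω)‖ ^ 2}
  let E₃ : Set Ω := {ω | ‖L (sampleVector N T fun t => x t ω)‖ ^ 2 ≤ (1 + γ) * V}
  have hm₂ : MeasurableSet E₂ := by
    have hLm : Measurable fun ω => L (sampleVector N T fun t => x t ω) :=
      L.continuous.measurable.comp hYm
    exact measurableSet_le (measurable_norm_applyMatrix_sq hAm hLm) (by fun_prop)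
  have hm₃ : MeasurableSet E₃ :=
    measurableSet_le ((L.continuous.measurable.comp hYm).norm.pow_const 2) measurable_const
  have hprob := one_sub_le_measureReal_inter (P := P) (p₁ := β)
    (p₂ := 4 * Real.exp (-c₁ η * M)) (p₃ := 2 * Real.exp (-min (γ ^ 2 / 112 ^ 2) (γ / 112)))
    hβ.le (by positivity) (by positivity) (hAm' hG₁m) hm₂ hm₃ (by
      rw [← Set.preimage_compl, ← Measure.map_apply hAm' hG₁m.compl, hAlaw]
      exact hG₁) (by
      simp only [E₂, Set.compl_ofPred, not_le]
      exact hG₂) (by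
      simp only [E₃, Set.compl_ofPred, not_le]
      refine le_trans hG₃ (ENNReal.ofReal_le_ofReal ?_)
      -- The tail bound holds with prefactor 1; the prefactor 2 of the statement is slack.
      linarith [Real.exp_pos (-min (γ ^ 2 / 112 ^ 2) (γ / 112))])
  refine ⟨_, ((hAm' hG₁m).inter hm₂).inter hm₃, hprob, ?_⟩
  rintro ω ⟨⟨hω₁, hω₂⟩, hω₃⟩ Ψ xs x' R u rfl hxs hx' hR hu
  simp only [E₂, E₃, Set.mem_ofPred_eq, ← hxs] at hω₂ hω₃
  have hLx : L xs = xs - x' := by rw [hx']; rfl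
  rw [hLx] at hω₂ hω₃
  have hx'U : x' ∈ U := by rw [hx']; exact Submodule.starProjection_apply_mem _ _
  have hRIPω : BlockRIP (A ω) (multibandDictionary (k := k) J hk Bnyq B T s) (2 * K) δ :=
    hRIP (fun p => A ω p.1 p.2) hω₁
  exact hu.norm_sub_sq_le hδ0 hδ hμ1 hμ2 hRIPω hI.le hx'U hη.le hτ hω₂ hω₃ hR
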